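/- Fix an integer $r\ge 1$. A congruence $\bigcup_{k\in L}A_k\cong\bigcup_{k\in R}A_k$ in the variables $A_1,\dots,A_r$ is given by two sets $L,R\subseteq\{1,\dots,r\}$, and a system of congruences is a set of congruences. If a group $G$ acts on a set $X$, then subsets $A_1,\dots,A_r$ of $X$ satisfy the system if they are pairwise disjoint and for each congruence $(L,R)$ of the system there is $\sigma\in G$ with $\sigma\bigl(\bigcup_{k\in L}A_k\bigr)=\bigcup_{k\in R}A_k$. Let $F$ be a group freely generated by $f_1,\dots,f_m$, acting on itself by left multiplication. Join $g$ to $f_ig$ by an edge for all $g\in F$ and $i\le m$. A set $S\subseteq F$ is connected if, for all $g,g'\in S$, every element on the shortest path from $g$ to $g'$ lies in $S$. For finite $S\subseteq F$, $g\in S$ and $i\le m$, the line in the $i$-direction through $g$ is the set of all $f_i^jg$, $j\in\mathbb Z$, such that $f_i^lg\in S$ for all integers $l$ between $0$ and $j$ (inclusive). A finite set $S$ is prime if, for each $i\le m$, the cardinalities of its lines in the $i$-direction have no common factor greater than $1$. A suitable space is a pair $(X,G)$ in which $X$ is a nonempty Polish space and $G$ is a countable group, free on more than one generator, which acts on $X$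 by homeomorphisms and acts freely on a comeager subset of $X$. Theorem 4.3. Suppose that for a system of congruences in $A_1,\dots,A_r$ there are a free group $F$ on finitely many generators $f_1,\dots,f_m$ and pairwise disjoint nonempty finite subsets $P_1,\dots,P_r$ of $F$ which satisfy the system (with witnesses in $F$), such that $P_1\cup\dots\cup P_r$ is connected and prime. Then, for every suitable space $(X,G)$, there are nonempty, pairwise disjoint open subsets $A_1,\dots,A_r$ of $X$ such that $A_1\cup\dots\cup A_r$ is dense in $X$ and $A_1,\dots,A_r$ satisfy the system (with witnesses in $G$). -/

import Mathlib

/-- A formal congruence `⋃_{k ∈ L} A_k ≅ ⋃_{k ∈ R} A_k` in the variables `A_k`, `k : Fin r`,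
given by the two index sets `L = left` and `R = right`. -/
structure SetCongruence (r : ℕ) where
  left : Set (Fin r)
  right : Set (Fin r)

/-- The subsets `A k` of the `G`-set `X` satisfy a system of congruences: they are pairwise
disjoint and every congruence of the system is witnessed by an element of `G`. -/
def SatisfiesCongruences (G : Type*) {X : Type*} [Group G] [MulAction G X] {r : ℕ}
    (C : Set (SetCongruence r)) (A : Fin r → Set X) : Prop :=
  (∀ k l : Fin r, k ≠ l → Disjoint (A k) (A l)) ∧
    ∀ c ∈ C, ∃ σ : G, (fun x : X => σ • x) '' (⋃ k ∈ c.left, A k) = ⋃ k ∈ c.right, A k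

/-- `(X, G)` is a suitable space: `X` is a Polish space (i.e. its topology comes from a complete
separable metric), and `G` is a countable group, free on more than one generator, that acts on `X`
by homeomorphisms and acts freely on a comeager set. -/
structure IsSuitableSpace (X : Type*) (G : Type*) [TopologicalSpace X] [Group G]
    [MulAction G X] : Prop where
  polish : PolishSpace X
  countable : Countable G
  free : ∃ S : Set G, S.Nontrivial ∧ ∃ b : FreeGroupBasis S G, ∀ s : S, b s = s
  continuous_smul : ∀ g : G, Continuous fun x : X => g • x
  acts_freely : ∃ Y ∈ residual X, ∀ g : G, g ≠ 1 → ∀ x ∈ Y, g • x ≠ x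

/-- The graph on the free group in which `g` is joined to `f_i g` for every generator `f_i`
(multiplication by generators and their inverses on the left). -/
def leftCayleyGraph (m : ℕ) : SimpleGraph (FreeGroup (Fin m)) :=
  SimpleGraph.fromRel fun g h => ∃ i : Fin m, h = FreeGroup.of i * g

/-- A subset `S` of the free group is connected if, for all `g, g' ∈ S`, all the group elements
along the shortest path from `g` to `g'` are in `S`. -/
def IsConnectedSubset {m : ℕ} (S : Set (FreeGroup (Fin m))) : Prop :=
  ∀ g ∈ S, ∀ g' ∈ S, ∀ p : (leftCayleyGraph m).Walk g g',
    p.length = (leftCayleyGraph m).dist g g' → ∀ h ∈ p.support, h ∈ S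

/-- The maximal line in the `i`-direction through `g` within `S`: all `f_i ^ j * g` such that
`f_i ^ l * g ∈ S` for all integers `l` between `0` and `j`. -/
def lineThrough {m : ℕ} (S : Set (FreeGroup (Fin m))) (i : Fin m) (g : FreeGroup (Fin m)) :
    Set (FreeGroup (Fin m)) :=
  {h | ∃ j : ℤ, h = FreeGroup.of i ^ j * g ∧
    ∀ l ∈ Set.uIcc 0 j, FreeGroup.of i ^ l * g ∈ S}

/-- A finite subset `S` of the free group is prime if, for each `i`, the cardinalities of the
lines in the `i`-direction for `S` have no common factor greater than `1`. -/
def IsPrimeSubset {m : ℕ} (S : Set (FreeGroup (Fin m))) : Prop :=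
  ∀ i : Fin m, ∀ d : ℕ, 1 < d → ¬ ∀ g ∈ S, d ∣ (lineThrough S i g).ncard

/-!
Every orbit with trivial stabilizer is a copy of the free group `F` on `m` generators, once `F` is
embedded into `G`. It is enough to find an open set `U` of centres such that the translates `p U`,
for `p` in the prototile `P = P₁ ∪ ⋯ ∪ Pᵣ`, are pairwise disjoint with dense union: then
`A k = P k • U` works, since the group element that carries one union of the `P k` to another carries
the corresponding unions of the `A k` to each other.

The graph on `F` that joins `g` to `c g` for letters `c` is a tree, and right translations are
automorphisms of it, so an orbit is to be tiled by right translates of a finite subtree `P` of this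
tree. The set `U` is the union of an increasing sequence of open sets, each of which reaches one more
member of a countable base (`exists_isOpen_tiling`). In a step, finitely many tiles are added around
a generic point `x₀` and are copied at all points of a small neighbourhood of `x₀`
(`IsExtendable.exists_cover`). A generic orbit meets no boundary of the earlier sets, so nearby
points see the same picture as `x₀`, and if the neighbourhood is small, the new copies on any orbit
are extremely far apart. The difficulty is never to leave holes that cannot be filled later. The
invariant `IsExtendable` that guarantees this says that the components of the covered part of an
orbit have distance at least a constant `K`, and that chains of components with gaps shorter than a
larger constant `s` are bounded. By the second property only finitely many components are near
`x₀`; the new tiles merge those that are too close into a single component, one after another,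
always filling the path to a nearest one (`exists_isMerge_far`). As the filled path is a shortest
one, its vertices are at distance at least `K / 2` from all other components, so there is always
room.

It remains to fill a long path of the tree exactly with disjoint tiles
(`exists_forall_fillable`). Where the path turns, from an edge with letter `b` to one with letter
`c ≠ b`, maximizing over `P` a homomorphism from `F` to `ℤ` gives a tile which leaves the path. An
element of `P` of maximal norm shows that in all directions but one some line of `P` has length one,
so a path which uses another direction can be filled from both ends (`fillable_of_hasUnitLine`). The
remaining paths are straight, and a long straight path can be filled since, `P` being prime, every
large number is a sum of lengths of lines of `P`.
-/

namespace GroupTiling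

open FreeGroup (IsReduced)
open scoped Topology

section Tree

variable {α : Type*}

/-! ### The tree of a free group -/

/-- A letter of the free group on `α`: a generator (`true`) or the inverse of one (`false`). -/
abbrev Letter (α : Type*) := α × Bool

theorem mk_cons (c : Letter α) (l : List (Letter α)) :
    (FreeGroup.mk (c :: l) : FreeGroup α) = FreeGroup.mk [c] * FreeGroup.mk l := by
  simp

theorem inv_mk_letter (c : Letter α) :
    (FreeGroup.mk [c] : FreeGroup α)⁻¹ = FreeGroup.mk [(c.1, !c.2)] := by
  simp [FreeGroup.inv_mk, FreeGroup.invRev]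

/-- `S` is connected in the graph that joins `z` to `c z` for every letter `c`: a predicate which
is constant along the edges inside `S` is constant on `S`. -/
def Conn (S : Set (FreeGroup α)) : Prop :=
  ∀ f : FreeGroup α → Prop,
    (∀ z ∈ S, ∀ c : Letter α, FreeGroup.mk [c] * z ∈ S → (f z ↔ f (FreeGroup.mk [c] * z))) →
      ∀ u ∈ S, ∀ v ∈ S, (f u ↔ f v)

theorem Conn.union {S T : Set (FreeGroup α)} (hS : Conn S) (hT : Conn T) {z : FreeGroup α}
    (hzS : z ∈ S) (hzT : z ∈ T) : Conn (S ∪ T) := by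
  intro f hf u hu v hv
  have h1 := hS f fun w hw c hc => hf w (Or.inl hw) c (Or.inl hc)
  have h2 := hT f fun w hw c hc => hf w (Or.inr hw) c (Or.inr hc)
  have key : ∀ u ∈ S ∪ T, (f u ↔ f z) := by
    rintro u (hu | hu)
    · exact h1 u hu z hzS
    · exact h2 u hu z hzT
  rw [key u hu, key v hv]

theorem Conn.translate {S : Set (FreeGroup α)} (hS : Conn S) (g : FreeGroup α) :
    Conn {z | z * g ∈ S} := by
  intro f hf u hu v hv
  have := hS (fun z => f (z * g⁻¹)) (fun z hz c hc => by
    have := hf (z * g⁻¹) (by simpa using hz) c (by simpa [mul_assoc] using hc)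
    simpa [mul_assoc] using this) _ hu _ hv
  simpa using this

/-- Two points of `D` are joined in `D` if some connected subset of `D` contains both. -/
def Joined (D : Set (FreeGroup α)) (u v : FreeGroup α) : Prop :=
  ∃ S ⊆ D, Conn S ∧ u ∈ S ∧ v ∈ S

theorem Joined.mono {D D' : Set (FreeGroup α)} (h : D ⊆ D') {u v : FreeGroup α}
    (huv : Joined D u v) : Joined D' u v := by
  obtain ⟨S, hS, h1⟩ := huv
  exact ⟨S, hS.trans h, h1⟩

theorem Joined.trans {D : Set (FreeGroup α)} {u v w : FreeGroup α} (h : Joined D u v)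
    (h' : Joined D v w) : Joined D u w := by
  obtain ⟨S, hS, h1, h2, h3⟩ := h
  obtain ⟨T, hT, h4, h5, h6⟩ := h'
  exact ⟨S ∪ T, Set.union_subset hS hT, h1.union h4 h3 h5, Or.inl h2, Or.inr h6⟩

theorem Joined.symm {D : Set (FreeGroup α)} {u v : FreeGroup α} (h : Joined D u v) :
    Joined D v u := by
  obtain ⟨S, hS, h1, h2, h3⟩ := h
  exact ⟨S, hS, h1, h3, h2⟩

theorem conn_singleton (u : FreeGroup α) : Conn {u} := by
  rintro f - a rfl b rfl
  rfl

theorem Joined.refl {D : Set (FreeGroup α)} {u : FreeGroup α} (h : u ∈ D) : Joined D u u :=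
  ⟨{u}, by simpa using h, conn_singleton u, rfl, rfl⟩

theorem Joined.mem {D : Set (FreeGroup α)} {u v : FreeGroup α} (h : Joined D u v) : v ∈ D := by
  obtain ⟨S, hS, -, -, h3⟩ := h
  exact hS h3

theorem conn_setOf_joined (D : Set (FreeGroup α)) (u : FreeGroup α) :
    Conn {v | Joined D u v} := by
  have key : ∀ f : FreeGroup α → Prop, (∀ z ∈ {v | Joined D u v}, ∀ c : Letter α,
      FreeGroup.mk [c] * z ∈ {v | Joined D u v} → (f z ↔ f (FreeGroup.mk [c] * z))) →
      ∀ v ∈ {v | Joined D u v}, (f u ↔ f v) := by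
    rintro f hf v ⟨S, hS, h1, h2, h3⟩
    have : ∀ z ∈ S, Joined D u z := fun z hz => ⟨S, hS, h1, h2, hz⟩
    exact h1 f (fun z hz c hc => hf z (this z hz) c (this _ hc)) u h2 v h3
  intro f hf v hv w hw
  rw [← key f hf v hv, ← key f hf w hw]

variable [DecidableEq α]

theorem toWord_letter_mul_of_cancel (c : Letter α) (g : FreeGroup α) (t : List (Letter α))
    (h : g.toWord = (c.1, !c.2) :: t) : (FreeGroup.mk [c] * g).toWord = t := by
  have hg : FreeGroup.reduce ((c.1, !c.2) :: t) = (c.1, !c.2) :: t := by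
    rw [← h, FreeGroup.reduce_toWord]
  rw [FreeGroup.toWord_mul, FreeGroup.toWord_mk, h]
  simp only [FreeGroup.reduce_singleton, List.singleton_append]
  rw [FreeGroup.reduce.cons, hg]
  simp

theorem toWord_letter_mul_of_ne (c : Letter α) (g : FreeGroup α)
    (h : g.toWord.head? ≠ some (c.1, !c.2)) :
    (FreeGroup.mk [c] * g).toWord = c :: g.toWord := by
  rw [FreeGroup.toWord_mul, FreeGroup.toWord_mk]
  simp only [FreeGroup.reduce_singleton, List.singleton_append]
  rw [FreeGroup.reduce.cons, FreeGroup.reduce_toWord]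
  rcases hw : g.toWord with _ | ⟨d, t⟩
  · rfl
  · rw [hw] at h
    have : ¬ (c.1 = d.1 ∧ c.2 = !d.2) := by
      rintro ⟨h1, h2⟩
      apply h
      simp only [List.head?_cons, Option.some.injEq]
      ext <;> simp [h1, h2]
    simp [this]

/-- The half of the tree beyond the edge from `y` to `b y`: the `z` such that the reduced word
of `z y⁻¹`, which spells the path from `y` to `z` from right to left, starts that path with the
letter `b`. -/
def halfTree (y : FreeGroup α) (b : Letter α) : Set (FreeGroup α) :=
  {z | (z * y⁻¹).toWord.getLast? = some b}

theorem not_mem_halfTree_self (y : FreeGroup α) (b : Letter α) : y ∉ halfTree y b := by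
  simp [halfTree]

theorem letter_mul_mem_halfTree (y : FreeGroup α) (b : Letter α) :
    FreeGroup.mk [b] * y ∈ halfTree y b := by
  simp [halfTree, FreeGroup.toWord_mk]

/-- The edge from `y` to `b y` is the only one that joins the two halves of the tree. -/
theorem halfTree_step (y : FreeGroup α) (b c : Letter α) (z : FreeGroup α) :
    (z ∈ halfTree y b ↔ FreeGroup.mk [c] * z ∈ halfTree y b) ∨
      (z = y ∧ FreeGroup.mk [c] * z = FreeGroup.mk [b] * y) ∨
      (z = FreeGroup.mk [b] * y ∧ FreeGroup.mk [c] * z = y) := by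
  obtain ⟨g, rfl⟩ : ∃ g, z = g * y := ⟨z * y⁻¹, by simp⟩
  simp only [halfTree, Set.mem_ofPred_eq, mul_assoc, mul_inv_cancel, mul_one]
  simp only [← mul_assoc, mul_left_inj]
  by_cases h : g.toWord.head? = some (c.1, !c.2)
  · obtain ⟨t, ht⟩ : ∃ t, g.toWord = (c.1, !c.2) :: t := by
      rcases hw : g.toWord with _ | ⟨d, t⟩ <;> simp_all
    have h1 := toWord_letter_mul_of_cancel c g t ht
    rw [h1, ht]
    rcases t with _ | ⟨d, t⟩
    · by_cases hb : (c.1, !c.2) = b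
      · right; right
        have hg : g = FreeGroup.mk [(c.1, !c.2)] := by rw [← FreeGroup.mk_toWord (x := g), ht]
        exact ⟨by rw [hg, hb], by rw [hg, ← inv_mk_letter, mul_inv_cancel, one_mul]⟩
      · left; simpa using hb
    · left; simp
  · rw [toWord_letter_mul_of_ne c g h]
    rcases hw : g.toWord with _ | ⟨d, t⟩
    · by_cases hb : c = b
      · right; left
        have hg : g = 1 := FreeGroup.toWord_eq_nil_iff.1 hw
        subst hb
        simp [hg]
      · left; simpa using hb
    · left; simp

/-- A connected set which does not contain both ends of an edge lies on one side of it. -/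
theorem Conn.mem_halfTree_iff {S : Set (FreeGroup α)} (hS : Conn S) {y : FreeGroup α}
    {b : Letter α} (h : y ∈ S → FreeGroup.mk [b] * y ∉ S) {u v : FreeGroup α} (hu : u ∈ S)
    (hv : v ∈ S) : u ∈ halfTree y b ↔ v ∈ halfTree y b := by
  refine hS (fun z => z ∈ halfTree y b) (fun z hz c hc => ?_) u hu v hv
  rcases halfTree_step y b c z with h1 | ⟨h1, h2⟩ | ⟨h1, h2⟩
  · exact h1
  · exact absurd (h2 ▸ hc) (h (h1 ▸ hz))
  · exact absurd (h1 ▸ hz) (h (h2 ▸ hc))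

/-- The end of a reduced path that runs through an edge lies beyond that edge. -/
theorem mem_halfTree_of_isReduced {l₁ l₂ : List (Letter α)} {b : Letter α}
    (h : IsReduced (l₁ ++ b :: l₂)) (y : FreeGroup α) :
    FreeGroup.mk (l₁ ++ b :: l₂) * y ∈ halfTree (FreeGroup.mk l₂ * y) b := by
  have h1 : IsReduced (l₁ ++ [b]) := h.infix ⟨[], l₂, by simp⟩
  have h2 : FreeGroup.mk (l₁ ++ b :: l₂) * y * (FreeGroup.mk l₂ * y)⁻¹
      = FreeGroup.mk (l₁ ++ [b]) := by
    rw [show l₁ ++ b :: l₂ = (l₁ ++ [b]) ++ l₂ by simp, ← FreeGroup.mul_mk]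
    group
  rw [halfTree, Set.mem_ofPred_eq, h2, FreeGroup.toWord_mk, h1.reduce_eq]
  simp

/-- A vertex before the edge `b` of a reduced path is not beyond that edge. -/
theorem not_mem_halfTree_of_isReduced {l₁ l₂ : List (Letter α)} {b : Letter α}
    (h : IsReduced (b :: l₁ ++ l₂)) (y : FreeGroup α) :
    FreeGroup.mk l₂ * y ∉ halfTree (FreeGroup.mk (l₁ ++ l₂) * y) b := by
  have h1 : IsReduced (b :: l₁) := h.infix ⟨[], l₂, by simp⟩
  have h2 : FreeGroup.mk l₂ * y * (FreeGroup.mk (l₁ ++ l₂) * y)⁻¹ = (FreeGroup.mk l₁)⁻¹ := by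
    rw [← FreeGroup.mul_mk]
    group
  have h3 : IsReduced l₁ := h1.infix ⟨[b], [], by simp⟩
  rw [halfTree, Set.mem_ofPred_eq, h2, FreeGroup.toWord_inv, FreeGroup.toWord_mk, h3.reduce_eq]
  rcases l₁ with _ | ⟨d, t⟩
  · simp [FreeGroup.invRev]
  · have h4 : b.1 = d.1 → b.2 = d.2 := (FreeGroup.isReduced_cons_cons.1 h1).1
    simp only [FreeGroup.invRev, List.map_cons, List.reverse_cons, List.getLast?_append,
      List.getLast?_singleton, Option.some_or, ne_eq, Option.some.injEq]
    rintro rfl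
    simp at h4

/-- The distance of the tree, measured by the word norm, satisfies the triangle inequality. -/
theorem norm_mul_inv_le (u v w : FreeGroup α) :
    (u * w⁻¹).norm ≤ (u * v⁻¹).norm + (v * w⁻¹).norm := by
  have := FreeGroup.norm_mul_le (u * v⁻¹) (v * w⁻¹)
  rwa [show u * v⁻¹ * (v * w⁻¹) = u * w⁻¹ by group] at this

theorem norm_mul_inv_comm (u v : FreeGroup α) : (u * v⁻¹).norm = (v * u⁻¹).norm := by
  rw [← FreeGroup.norm_inv_eq]
  congr 1
  group

theorem finite_norm_le [Finite α] (n : ℕ) : {g : FreeGroup α | g.norm ≤ n}.Finite := by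
  refine Set.Finite.of_finite_image ((List.finite_length_le (Letter α) n).subset ?_)
    (FreeGroup.toWord_injective.injOn)
  rintro _ ⟨g, hg, rfl⟩
  exact hg

end Tree

section Tiles

variable {α : Type*}

/-! ### Filling paths of the tree with tiles -/

/-- The tile `P w`, a right translate of the prototile `P`. Right translations are automorphisms
of the graph that joins `z` to `c z`. -/
def tile (P : Set (FreeGroup α)) (w : FreeGroup α) : Set (FreeGroup α) := {z | z * w⁻¹ ∈ P}

/-- The union `P W` of the tiles with centres in `W`. -/
def tiles (P W : Set (FreeGroup α)) : Set (FreeGroup α) := {z | ∃ w ∈ W, z ∈ tile P w}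

/-- Distinct tiles with centres in `W` are disjoint. -/
def TilesDisjoint (P W : Set (FreeGroup α)) : Prop :=
  ∀ w ∈ W, ∀ w' ∈ W, ∀ z, z ∈ tile P w → z ∈ tile P w' → w = w'

theorem conn_tile {P : Set (FreeGroup α)} (hP : Conn P) (w : FreeGroup α) : Conn (tile P w) :=
  hP.translate w⁻¹

/-- The path from `y` spelled by `l` (read from right to left, so that its vertices are the `s y`
for the suffixes `s` of `l`) can be filled exactly: finitely many disjoint tiles, each of which
contains an inner vertex of the path, cover all inner vertices and neither of the two ends. -/
def Fillable (P : Set (FreeGroup α)) (l : List (Letter α)) : Prop :=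
  ∀ y : FreeGroup α, ∃ W : Set (FreeGroup α), W.Finite ∧
    (∀ w ∈ W, ∃ l₁ l₂, l = l₁ ++ l₂ ∧ l₁ ≠ [] ∧ l₂ ≠ [] ∧ FreeGroup.mk l₂ * y ∈ tile P w) ∧
    (∀ w ∈ W, y ∉ tile P w ∧ FreeGroup.mk l * y ∉ tile P w) ∧
    TilesDisjoint P W ∧
    (∀ l₁ l₂, l = l₁ ++ l₂ → l₁ ≠ [] → l₂ ≠ [] → FreeGroup.mk l₂ * y ∈ tiles P W)

theorem fillable_singleton (P : Set (FreeGroup α)) (c : Letter α) : Fillable P [c] := by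
  intro y
  refine ⟨∅, Set.finite_empty, by simp, by simp, by simp [TilesDisjoint], ?_⟩
  intro l₁ l₂ h h1 h2
  have := congrArg List.length h
  rw [List.length_append] at this
  have := List.length_pos_iff.2 h1
  have := List.length_pos_iff.2 h2
  simp at *
  omega

theorem Fillable.invRev {P : Set (FreeGroup α)} {l : List (Letter α)} (h : Fillable P l) :
    Fillable P (FreeGroup.invRev l) := by
  intro y
  obtain ⟨W, hW, h1, h2, h3, h4⟩ := h (FreeGroup.mk (FreeGroup.invRev l) * y)
  have e : FreeGroup.mk l * (FreeGroup.mk (FreeGroup.invRev l) * y) = y := by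
    rw [← FreeGroup.inv_mk]; group
  have key : ∀ l₁ l₂ : List (Letter α), l = l₁ ++ l₂ →
      FreeGroup.mk l₂ * (FreeGroup.mk (FreeGroup.invRev l) * y)
        = FreeGroup.mk (FreeGroup.invRev l₁) * y := by
    rintro l₁ l₂ rfl
    rw [← FreeGroup.inv_mk, ← FreeGroup.inv_mk, ← FreeGroup.mul_mk]
    group
  have hne : ∀ l : List (Letter α), l ≠ [] → FreeGroup.invRev l ≠ [] := by
    intro l hl h
    apply hl
    have := congrArg List.length h
    rw [FreeGroup.invRev_length] at this
    simpa using this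
  refine ⟨W, hW, ?_, ?_, h3, ?_⟩
  · intro w hw
    obtain ⟨l₁, l₂, rfl, hl₁, hl₂, hz⟩ := h1 w hw
    refine ⟨FreeGroup.invRev l₂, FreeGroup.invRev l₁, FreeGroup.invRev_append, hne _ hl₂,
      hne _ hl₁, ?_⟩
    rwa [key _ _ rfl] at hz
  · intro w hw
    have := h2 w hw
    rw [e] at this
    exact ⟨this.2, this.1⟩
  · intro l₁ l₂ hl hl₁ hl₂
    have hl' : l = FreeGroup.invRev l₂ ++ FreeGroup.invRev l₁ := by
      rw [← FreeGroup.invRev_append, ← hl, FreeGroup.invRev_invRev]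
    have := h4 _ _ hl' (hne _ hl₂) (hne _ hl₁)
    rwa [key _ _ hl', FreeGroup.invRev_invRev] at this

/-- A single tile fills a path if its inner vertices, counted from the far end, correspond to
elements of the prototile, while the two ends do not. -/
theorem fillable_of_mem {P : Set (FreeGroup α)} {c : Letter α} {u : List (Letter α)}
    (hu : u ≠ []) {p : FreeGroup α} (hp : p ∈ P) (hc : FreeGroup.mk [c] * p ∉ P)
    (hend : (FreeGroup.mk u)⁻¹ * p ∉ P)
    (hin : ∀ s₁ s₂, u = s₁ ++ s₂ → s₂ ≠ [] → (FreeGroup.mk s₁)⁻¹ * p ∈ P) :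
    Fillable P (c :: u) := by
  intro y
  have e : ∀ s₁ s₂, u = s₁ ++ s₂ →
      FreeGroup.mk s₂ * y * (p⁻¹ * (FreeGroup.mk u * y))⁻¹ = (FreeGroup.mk s₁)⁻¹ * p := by
    rintro s₁ s₂ rfl
    rw [← FreeGroup.mul_mk]
    group
  refine ⟨{p⁻¹ * (FreeGroup.mk u * y)}, Set.finite_singleton _, ?_, ?_, ?_, ?_⟩
  · rintro w rfl
    refine ⟨[c], u, rfl, by simp, hu, ?_⟩
    rw [tile, Set.mem_ofPred_eq, e [] u rfl, ← FreeGroup.one_eq_mk, inv_one, one_mul]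
    exact hp
  · rintro w rfl
    refine ⟨?_, ?_⟩
    · have := e u [] (by simp)
      rw [← FreeGroup.one_eq_mk, one_mul] at this
      rw [tile, Set.mem_ofPred_eq, this]
      exact hend
    · rw [tile, Set.mem_ofPred_eq, mk_cons]
      have : FreeGroup.mk [c] * FreeGroup.mk u * y * (p⁻¹ * (FreeGroup.mk u * y))⁻¹
          = FreeGroup.mk [c] * p := by group
      rw [this]
      exact hc
  · rintro w rfl w' rfl - - -
    rfl
  · intro l₁ l₂ hl hl₁ hl₂
    obtain ⟨d, s₁, rfl⟩ := List.exists_cons_of_ne_nil hl₁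
    simp only [List.cons_append, List.cons.injEq] at hl
    refine ⟨_, rfl, ?_⟩
    rw [tile, Set.mem_ofPred_eq, e _ _ hl.2]
    exact hin _ _ hl.2 hl₂

variable [DecidableEq α]

/-- Exact fillings of the two parts of a path before and behind an edge, both including that edge,
combine: the edge separates the tiles of one from the tiles of the other. -/
theorem Fillable.append {P : Set (FreeGroup α)} (hP : Conn P) {l₁ l₂ : List (Letter α)}
    {b : Letter α} (h : IsReduced (l₁ ++ b :: l₂)) (h1 : Fillable P (l₁ ++ [b]))
    (h2 : Fillable P (b :: l₂)) : Fillable P (l₁ ++ b :: l₂) := by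
  intro y
  obtain ⟨W₁, f1, a1, b1, c1, d1⟩ := h1 (FreeGroup.mk l₂ * y)
  obtain ⟨W₂, f2, a2, b2, c2, d2⟩ := h2 y
  have e : ∀ a, FreeGroup.mk (a ++ [b]) * (FreeGroup.mk l₂ * y)
      = FreeGroup.mk (a ++ b :: l₂) * y := by
    intro a
    rw [← mul_assoc, FreeGroup.mul_mk]
    simp
  have v1 : ∀ w ∈ W₁, ∃ m a, l₁ = m ++ a ∧ m ≠ [] ∧ FreeGroup.mk (a ++ b :: l₂) * y ∈ tile P w := by
    intro w hw
    obtain ⟨m, s, hs, hm, hs', hz⟩ := a1 w hw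
    rcases List.eq_nil_or_concat s with rfl | ⟨a, b', rfl⟩
    · exact absurd rfl hs'
    · rw [List.concat_eq_append, ← List.append_assoc] at hs
      obtain ⟨rfl, hb⟩ := List.append_inj' hs rfl
      simp only [List.cons.injEq, and_true] at hb
      subst hb
      refine ⟨m, a, rfl, hm, ?_⟩
      rwa [List.concat_eq_append, e] at hz
  have v2 : ∀ w ∈ W₂, ∃ m s, l₂ = m ++ s ∧ s ≠ [] ∧ FreeGroup.mk s * y ∈ tile P w := by
    intro w hw
    obtain ⟨m, s, hs, hm, hs', hz⟩ := a2 w hw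
    obtain ⟨d, m', rfl⟩ := List.exists_cons_of_ne_nil hm
    simp only [List.cons_append, List.cons.injEq] at hs
    exact ⟨m', s, hs.2, hs', hz⟩
  have s1 : ∀ w ∈ W₁, ∀ z ∈ tile P w, z ∈ halfTree (FreeGroup.mk l₂ * y) b := by
    intro w hw z hz
    obtain ⟨m, a, rfl, hm, hv⟩ := v1 w hw
    rw [(conn_tile hP w).mem_halfTree_iff (fun h => absurd h (b1 w hw).1) hz hv]
    exact mem_halfTree_of_isReduced (h.infix ⟨m, [], by simp⟩) y
  have s2 : ∀ w ∈ W₂, ∀ z ∈ tile P w, z ∉ halfTree (FreeGroup.mk l₂ * y) b := by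
    intro w hw z hz
    obtain ⟨m, s, rfl, hs, hv⟩ := v2 w hw
    rw [(conn_tile hP w).mem_halfTree_iff (fun _ => ?_) hz hv]
    · exact not_mem_halfTree_of_isReduced (h.infix ⟨l₁, [], by simp⟩) y
    · rw [← mul_assoc, ← mk_cons]
      exact (b2 w hw).2
  refine ⟨W₁ ∪ W₂, f1.union f2, ?_, ?_, ?_, ?_⟩
  · rintro w (hw | hw)
    · obtain ⟨m, a, rfl, hm, hv⟩ := v1 w hw
      exact ⟨m, a ++ b :: l₂, by simp, hm, by simp, hv⟩
    · obtain ⟨m, s, rfl, hs, hv⟩ := v2 w hw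
      exact ⟨l₁ ++ b :: m, s, by simp, by simp, hs, hv⟩
  · rintro w (hw | hw)
    · refine ⟨fun hy => ?_, ?_⟩
      · have := not_mem_halfTree_of_isReduced (l₁ := l₂) (l₂ := []) (b := b)
          (h.infix ⟨l₁, [], by simp⟩) y
        rw [← FreeGroup.one_eq_mk, one_mul, List.append_nil] at this
        exact this (s1 w hw _ hy)
      · rw [← e]
        exact (b1 w hw).2
    · exact ⟨(b2 w hw).1, fun hy => s2 w hw _ hy (mem_halfTree_of_isReduced h y)⟩
  · rintro w (hw | hw) w' (hw' | hw') z hz hz'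
    · exact c1 w hw w' hw' z hz hz'
    · exact absurd (s1 w hw z hz) (s2 w' hw' z hz')
    · exact absurd (s1 w' hw' z hz') (s2 w hw z hz)
    · exact c2 w hw w' hw' z hz hz'
  · intro m s hms hm hs
    rcases List.append_eq_append_iff.1 hms with ⟨a, rfl, ha⟩ | ⟨a, rfl, rfl⟩
    · rcases a with _ | ⟨d, a⟩
      · rw [List.nil_append] at ha
        subst ha
        obtain ⟨w, hw, hz⟩ := d1 l₁ [b] rfl (by simpa using hm) (by simp)
        exact ⟨w, Or.inl hw, by rwa [← List.nil_append [b], e, List.nil_append] at hz⟩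
      · obtain ⟨w, hw, hz⟩ := d2 (d :: a) s ha (by simp) hs
        exact ⟨w, Or.inr hw, hz⟩
    · obtain ⟨w, hw, hz⟩ := d1 m (a ++ [b]) (by simp) hm (by simp)
      exact ⟨w, Or.inl hw, by rwa [e] at hz⟩

end Tiles

section Words

variable {α : Type*}

/-! ### Which paths can be filled -/

/-- Some element of `P` has a line of length one in the direction `i`. -/
def HasUnitLine (P : Set (FreeGroup α)) (i : α) : Prop :=
  ∃ p ∈ P, ∀ t : Bool, FreeGroup.mk [(i, t)] * p ∉ P

theorem mk_replicate (k : ℕ) (c : Letter α) :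
    FreeGroup.mk (List.replicate k c) = (FreeGroup.mk [c] : FreeGroup α) ^ k := by
  rw [FreeGroup.pow_mk]; simp

theorem eq_replicate_or_exists (c : Letter α) (t : List (Letter α)) :
    t = List.replicate t.length c ∨
      ∃ k b t', b ≠ c ∧ t = List.replicate k c ++ b :: t' := by
  induction t with
  | nil => left; rfl
  | cons d t ih =>
    by_cases hd : d = c
    · subst hd
      rcases ih with ih | ⟨k, b, t', hb, ih⟩
      · left
        rw [List.length_cons, List.replicate_succ, ← ih]
      · right
        exact ⟨k + 1, b, t', hb, by rw [ih, List.replicate_succ, List.cons_append]⟩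
    · right
      exact ⟨0, d, t, hd, by simp⟩

theorem direction_ne_of_isReduced {b c : Letter α} {k : ℕ} {t : List (Letter α)} (hb : b ≠ c)
    (h : IsReduced (c :: (List.replicate k c ++ b :: t))) : c.1 ≠ b.1 := by
  intro hcb
  have h1 : IsReduced [c, b] := by
    refine h.infix ⟨List.replicate k c, t, ?_⟩
    have : List.replicate k c ++ [c] = c :: List.replicate k c := by
      rw [← List.replicate_succ', List.replicate_succ]
    calc List.replicate k c ++ [c, b] ++ t
        = (List.replicate k c ++ [c]) ++ b :: t := by simp
      _ = c :: (List.replicate k c ++ b :: t) := by rw [this]; simp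
  exact hb (Prod.ext hcb.symm ((FreeGroup.isReduced_cons_cons.1 h1).1 hcb).symm)

/-- Start a tile behind the edge `c` at the far end of a path so that it does not contain the whole
rest of the path. Then it fills exactly a piece of the path, which ends in an edge `d` that the
tile does not cross. -/
theorem exists_fillable_prefix {P : Set (FreeGroup α)} {c : Letter α} {t : List (Letter α)}
    {p : FreeGroup α} (hp : p ∈ P) (hc : FreeGroup.mk [c] * p ∉ P)
    (ht : ∃ t₁ t₂, t = t₁ ++ t₂ ∧ (FreeGroup.mk t₁)⁻¹ * p ∉ P) :
    ∃ t₁ d t₂, t = t₁ ++ d :: t₂ ∧ Fillable P (c :: (t₁ ++ [d])) := by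
  classical
  have hex : ∃ k, (FreeGroup.mk (t.take k))⁻¹ * p ∉ P := by
    obtain ⟨t₁, t₂, rfl, h⟩ := ht
    exact ⟨t₁.length, by simpa using h⟩
  obtain ⟨k, hk, hmin⟩ : ∃ k, (FreeGroup.mk (t.take k))⁻¹ * p ∉ P ∧
      ∀ j < k, (FreeGroup.mk (t.take j))⁻¹ * p ∈ P :=
    ⟨Nat.find hex, Nat.find_spec hex, fun j hj => not_not.1 (Nat.find_min hex hj)⟩
  rcases k with _ | k
  · exact absurd (by simpa [← FreeGroup.one_eq_mk] using hp) hk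
  have hkl : k < t.length := by
    by_contra hcon
    apply hk
    have h1 := hmin k (Nat.lt_succ_self k)
    rw [List.take_of_length_le (by omega)] at h1 ⊢
    exact h1
  refine ⟨t.take k, t[k], t.drop (k + 1), by simp, ?_⟩
  rw [List.take_append_getElem hkl]
  refine fillable_of_mem ?_ hp hc hk ?_
  · intro h
    have := congrArg List.length h
    rw [List.length_take, List.length_nil] at this
    omega
  · intro s₁ s₂ hs hs₂
    have hlen : s₁.length < k + 1 := by
      have h1 := congrArg List.length hs
      rw [List.length_take, List.length_append] at h1
      have h2 := List.length_pos_iff.2 hs₂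
      omega
    have : s₁ = t.take s₁.length := by
      have h1 := congrArg (List.take s₁.length) hs
      rw [List.take_take, min_eq_left hlen.le, List.take_left] at h1
      exact h1.symm
    rw [this]
    exact hmin _ hlen

variable [DecidableEq α]

theorem norm_letter_mul_of_ne (c : Letter α) (g : FreeGroup α)
    (h : g.toWord.head? ≠ some (c.1, !c.2)) :
    (FreeGroup.mk [c] * g).norm = g.norm + 1 := by
  rw [FreeGroup.norm, toWord_letter_mul_of_ne c g h, List.length_cons, FreeGroup.norm]

/-- An element of `P` of maximal norm has a neighbour in `P` in at most one direction. -/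
theorem hasUnitLine_or {P : Set (FreeGroup α)} (hfin : P.Finite) (hne : P.Nonempty) {i j : α}
    (hij : i ≠ j) : HasUnitLine P i ∨ HasUnitLine P j := by
  obtain ⟨p, hp, hmax⟩ := Set.exists_max_image P FreeGroup.norm hfin hne
  have key : ∀ c : Letter α, p.toWord.head? ≠ some (c.1, !c.2) → FreeGroup.mk [c] * p ∉ P := by
    intro c hc hcp
    have := hmax _ hcp
    rw [norm_letter_mul_of_ne c p hc] at this
    omega
  by_cases h : ∃ t, p.toWord.head? = some (i, t)
  · obtain ⟨t, ht⟩ := h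
    refine Or.inr ⟨p, hp, fun s => key _ ?_⟩
    rw [ht]
    simp [hij]
  · exact Or.inl ⟨p, hp, fun s => key _ fun h' => h ⟨_, h'⟩⟩

theorem exists_hom_letters {b c : Letter α} (h : b.1 ≠ c.1) (x y : ℤ) :
    ∃ φ : FreeGroup α →* Multiplicative ℤ, φ (FreeGroup.mk [b]) = Multiplicative.ofAdd x ∧
      φ (FreeGroup.mk [c]) = Multiplicative.ofAdd y := by
  obtain ⟨i, s⟩ := b
  obtain ⟨j, t⟩ := c
  refine ⟨FreeGroup.lift fun k => if k = i then (if s then Multiplicative.ofAdd x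
    else (Multiplicative.ofAdd x)⁻¹) else if k = j then (if t then Multiplicative.ofAdd y
    else (Multiplicative.ofAdd y)⁻¹) else 1, ?_, ?_⟩
  · cases s <;> simp [FreeGroup.lift_mk]
  · have : j ≠ i := fun h' => h h'.symm
    cases t <;> simp [FreeGroup.lift_mk, this]

variable {P : Set (FreeGroup α)}

/-- By induction, it is enough to find a tile that fills the far end of the path and does not
contain all the rest. If the path is straight, a line of length one does it. Otherwise choose
`p ∈ P` to maximize a homomorphism `φ` to `ℤ` that is positive on the first letter `c` at the far
end and sufficiently negative on the first different letter `b`; then the tile stops at the latest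
before the vertex behind the first change of direction. -/
theorem fillable_of_hasUnitLine_getLast (hP : Conn P) (hfin : P.Finite) (hne : P.Nonempty)
    {g : Letter α} (hg : HasUnitLine P g.1) {l : List (Letter α)} (hl : IsReduced l)
    (hlast : l.getLast? = some g) : Fillable P l := by
  induction hn : l.length using Nat.strong_induction_on generalizing l with
  | _ n ih =>
    subst hn
    rcases l with _ | ⟨c, t⟩
    · simp at hlast
    rcases eq_or_ne t [] with rfl | htne
    · exact fillable_singleton P c
    have key : ∃ p ∈ P, FreeGroup.mk [c] * p ∉ P ∧
        ∃ t₁ t₂, t = t₁ ++ t₂ ∧ (FreeGroup.mk t₁)⁻¹ * p ∉ P := by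
      rcases eq_replicate_or_exists c t with ht | ⟨k, b, t', hb, ht⟩
      · obtain ⟨d, t', rfl⟩ := List.exists_cons_of_ne_nil htne
        rw [List.length_cons, List.replicate_succ, List.cons.injEq] at ht
        obtain ⟨rfl, ht⟩ := ht
        have hgd : g = d := by
          rw [ht, ← List.replicate_succ, ← List.replicate_succ, List.getLast?_replicate] at hlast
          simpa using hlast.symm
        subst hgd
        obtain ⟨p, hp, hpt⟩ := hg
        refine ⟨p, hp, hpt _, [g], t', rfl, ?_⟩
        rw [inv_mk_letter]
        exact hpt _
      · have hbc : c.1 ≠ b.1 := direction_ne_of_isReduced hb (ht ▸ hl)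
        obtain ⟨φ, hφc, hφb⟩ := exists_hom_letters hbc 1 (-(k + 1))
        obtain ⟨p, hp, hmax⟩ := Set.exists_max_image P (fun p => (φ p).toAdd) hfin hne
        refine ⟨p, hp, fun h => ?_, List.replicate k c ++ [b], t', by simp [ht], fun h => ?_⟩
        · have := hmax _ h
          rw [map_mul, hφc, toAdd_mul, toAdd_ofAdd] at this
          omega
        · have := hmax _ h
          simp only [← FreeGroup.mul_mk, mk_replicate, map_mul, map_inv, map_pow, hφc, hφb, toAdd_mul,
            toAdd_inv, toAdd_pow, toAdd_ofAdd, nsmul_eq_mul] at this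
          omega
    obtain ⟨p, hp, hcp, ht⟩ := key
    obtain ⟨t₁, d, t₂, rfl, hfill⟩ := exists_fillable_prefix hp hcp ht
    refine Fillable.append (l₁ := c :: t₁) hP hl hfill ?_
    refine ih (d :: t₂).length ?_ (hl.infix ⟨c :: t₁, [], by simp⟩) ?_ rfl
    · simp
    · rw [← hlast, ← List.cons_append, List.getLast?_append_cons]

theorem isReduced_invRev {l : List (Letter α)} (hl : IsReduced l) :
    IsReduced (FreeGroup.invRev l) := by
  rw [FreeGroup.isReduced_iff_reduce_eq, FreeGroup.reduce_invRev, hl.reduce_eq]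

/-- A reduced path with an edge in a direction in which `P` has a line of length one can be
filled: fill the parts before and behind this edge. -/
theorem fillable_of_hasUnitLine (hP : Conn P) (hfin : P.Finite) (hne : P.Nonempty)
    {g : Letter α} (hg : HasUnitLine P g.1) {l : List (Letter α)} (hl : IsReduced l)
    (hgl : g ∈ l) : Fillable P l := by
  obtain ⟨l₁, l₂, rfl⟩ := List.append_of_mem hgl
  refine Fillable.append hP hl ?_ ?_
  · exact fillable_of_hasUnitLine_getLast hP hfin hne hg (hl.infix ⟨[], l₂, by simp⟩) (by simp)
  · have h1 : IsReduced (g :: l₂) := hl.infix ⟨l₁, [], by simp⟩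
    have h2 := fillable_of_hasUnitLine_getLast hP hfin hne (g := (g.1, !g.2)) hg
      (isReduced_invRev h1) (by simp [FreeGroup.invRev])
    simpa using h2.invRev

/-- The lengths of the lines of `P` in the direction of the letter `b`. -/
def lineLengths (P : Set (FreeGroup α)) (b : Letter α) : Set ℕ :=
  {k | ∃ p ∈ P, FreeGroup.mk [b] * p ∉ P ∧ (∀ j < k, ((FreeGroup.mk [b])⁻¹ ^ j) * p ∈ P) ∧
    ((FreeGroup.mk [b])⁻¹ ^ k) * p ∉ P}

theorem isReduced_replicate (k : ℕ) (c : Letter α) : IsReduced (List.replicate k c) := by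
  rw [FreeGroup.isReduced_iff_reduce_eq, FreeGroup.reduce_replicate]

theorem fillable_replicate (hP : Conn P) {b : Letter α} {n : ℕ}
    (hn : n ∈ AddSubmonoid.closure (lineLengths P b)) : Fillable P (List.replicate (n + 1) b) := by
  induction hn using AddSubmonoid.closure_induction with
  | mem k hk =>
    obtain ⟨p, hp, h1, h2, h3⟩ := hk
    rw [List.replicate_succ]
    refine fillable_of_mem ?_ hp h1 ?_ ?_
    · rintro h
      rw [List.replicate_eq_nil_iff] at h
      subst h
      exact h3 (by simpa using hp)
    · rwa [mk_replicate, ← inv_pow]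
    · intro s₁ s₂ hs hs₂
      obtain ⟨hlen, hs₁, -⟩ := List.append_eq_replicate_iff.1 hs.symm
      rw [hs₁, mk_replicate, ← inv_pow]
      have := List.length_pos_iff.2 hs₂
      exact h2 _ (by omega)
  | zero => exact fillable_singleton P b
  | add x y _ _ hx hy =>
    have h1 : List.replicate (x + y + 1) b = List.replicate x b ++ b :: List.replicate y b := by
      rw [← List.replicate_succ, List.replicate_append_replicate, add_assoc]
    rw [h1]
    refine Fillable.append hP ?_ ?_ ?_
    · rw [← h1]
      exact isReduced_replicate _ _
    · rwa [← List.replicate_succ']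
    · rwa [← List.replicate_succ]

/-- If the lines of `P` in every direction have lengths without common factor, then all
sufficiently long paths can be filled. A long path whose letters all have directions without lines
of length one is straight, and its length is a sum of line lengths. -/
theorem exists_forall_fillable [Finite α] (hP : Conn P) (hfin : P.Finite) (hne : P.Nonempty)
    (hgcd : ∀ b : Letter α, Nat.setGcd (lineLengths P b) = 1) :
    ∃ N, ∀ l : List (Letter α), IsReduced l → N < l.length → Fillable P l := by
  choose n hn using fun b : Letter α => Nat.exists_mem_closure_of_ge (lineLengths P b)
  obtain ⟨N, hN⟩ := (Set.finite_range n).bddAbove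
  refine ⟨N, fun l hl hlen => ?_⟩
  by_cases hg : ∃ g ∈ l, HasUnitLine P g.1
  · obtain ⟨g, hgl, hg⟩ := hg
    exact fillable_of_hasUnitLine hP hfin hne hg hl hgl
  push Not at hg
  obtain ⟨c, t, rfl⟩ := List.exists_cons_of_ne_nil (l := l) (by rintro rfl; simp at hlen)
  have hrep : t = List.replicate t.length c := by
    rcases eq_replicate_or_exists c t with ht | ⟨k, b, t', hb, ht⟩
    · exact ht
    · exfalso
      rcases hasUnitLine_or hfin hne (direction_ne_of_isReduced hb (ht ▸ hl)) with h | h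
      · exact hg c (by simp) h
      · exact hg b (by simp [ht]) h
  rw [hrep, ← List.replicate_succ]
  refine fillable_replicate hP (hn c _ ?_ (by simp [hgcd]))
  have := hN (Set.mem_range_self c)
  rw [List.length_cons] at hlen
  omega

end Words

section Prime

variable {m : ℕ}

/-! ### Connected and prime subsets -/

theorem exists_letter_of_adj {g h : FreeGroup (Fin m)} (hgh : (leftCayleyGraph m).Adj g h) :
    ∃ c : Letter (Fin m), h = FreeGroup.mk [c] * g := by
  rw [leftCayleyGraph, SimpleGraph.fromRel_adj] at hgh
  rcases hgh with ⟨-, ⟨i, hi⟩ | ⟨i, hi⟩⟩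
  · exact ⟨(i, true), hi⟩
  · refine ⟨(i, false), ?_⟩
    have := inv_mk_letter (i, true)
    rw [Bool.not_true] at this
    rw [hi, ← this, FreeGroup.of, inv_mul_cancel_left]

theorem reachable_letter_mul (c : Letter (Fin m)) (g : FreeGroup (Fin m)) :
    (leftCayleyGraph m).Reachable g (FreeGroup.mk [c] * g) := by
  rcases eq_or_ne g (FreeGroup.mk [c] * g) with h | h
  · rw [← h]
  · refine SimpleGraph.Adj.reachable ?_
    rw [leftCayleyGraph, SimpleGraph.fromRel_adj]
    refine ⟨h, ?_⟩
    obtain ⟨i, t⟩ := c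
    cases t
    · right
      refine ⟨i, ?_⟩
      have := inv_mk_letter (i, true)
      rw [Bool.not_true] at this
      rw [← this, FreeGroup.of, mul_inv_cancel_left]
    · exact Or.inl ⟨i, rfl⟩

theorem reachable_leftCayleyGraph (g h : FreeGroup (Fin m)) :
    (leftCayleyGraph m).Reachable g h := by
  have key : ∀ l : List (Letter (Fin m)),
      (leftCayleyGraph m).Reachable g (FreeGroup.mk l * g) := by
    intro l
    induction l with
    | nil => rw [← FreeGroup.one_eq_mk, one_mul]
    | cons c l ih =>
      rw [mk_cons, mul_assoc]
      exact ih.trans (reachable_letter_mul c _)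
  have := key (h * g⁻¹).toWord
  rwa [FreeGroup.mk_toWord, inv_mul_cancel_right] at this

theorem conn_of_isConnectedSubset {S : Set (FreeGroup (Fin m))} (hS : IsConnectedSubset S) :
    Conn S := by
  intro f hf u hu v hv
  obtain ⟨p, hp⟩ := (reachable_leftCayleyGraph u v).exists_walk_length_eq_dist
  have key : ∀ {a b : FreeGroup (Fin m)} (q : (leftCayleyGraph m).Walk a b),
      (∀ x ∈ q.support, x ∈ S) → (f a ↔ f b) := by
    intro a b q
    induction q with
    | nil => intro _; rfl
    | cons hadj q ih =>
      intro hq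
      obtain ⟨c, rfl⟩ := exists_letter_of_adj hadj
      rw [← ih fun x hx => hq x (by simp [hx])]
      exact hf _ (hq _ (by simp)) c (hq _ (by simp))
  exact key p (hS u hu v hv p hp)

/-- In a finite set, the line through `g` consists of the `fᵢ ^ j * g` with `-c < j < a`, where `a`
and `-c` are the first exponents that lead out of the set. -/
theorem lineThrough_finite_data {S : Set (FreeGroup (Fin m))} (hS : S.Finite) (i : Fin m)
    {g : FreeGroup (Fin m)} (hg : g ∈ S) : ∃ a c : ℕ, 0 < a ∧ 0 < c ∧
      FreeGroup.of i ^ (a : ℤ) * g ∉ S ∧ FreeGroup.of i ^ (-(c : ℤ)) * g ∉ S ∧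
      (∀ j : ℤ, -c < j → j < a → FreeGroup.of i ^ j * g ∈ S) ∧
      (lineThrough S i g).ncard = a + c - 1 := by
  classical
  have hinj : Function.Injective fun j : ℤ => FreeGroup.of i ^ j * g := by
    intro j k hjk
    exact (injective_zpow_iff_not_isOfFinOrder.2
      (fun h => FreeGroup.of_ne_one i ((isOfFinOrder_iff_eq_one _).1 h))) (mul_right_cancel hjk)
  have hex : ∀ e : ℤ, e ≠ 0 → ∃ n : ℕ, FreeGroup.of i ^ (e * n) * g ∉ S := by
    intro e he
    by_contra hcon
    push Not at hcon
    refine Set.infinite_of_injective_forall_mem (f := fun n : ℕ => FreeGroup.of i ^ (e * n) * g)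
      ?_ hcon hS
    intro n k hnk
    have := hinj hnk
    exact_mod_cast mul_left_cancel₀ he this
  have h1 := hex 1 one_ne_zero
  have h2 := hex (-1) (by norm_num)
  simp only [one_mul, neg_one_mul] at h1 h2
  obtain ⟨a, ha, hamin⟩ : ∃ a : ℕ, FreeGroup.of i ^ (a : ℤ) * g ∉ S ∧
      ∀ k < a, FreeGroup.of i ^ (k : ℤ) * g ∈ S :=
    ⟨Nat.find h1, Nat.find_spec h1, fun k hk => not_not.1 (Nat.find_min h1 hk)⟩
  obtain ⟨c, hc, hcmin⟩ : ∃ a : ℕ, FreeGroup.of i ^ (-(a : ℤ)) * g ∉ S ∧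
      ∀ k < a, FreeGroup.of i ^ (-(k : ℤ)) * g ∈ S :=
    ⟨Nat.find h2, Nat.find_spec h2, fun k hk => not_not.1 (Nat.find_min h2 hk)⟩
  have ha0 : 0 < a := Nat.pos_of_ne_zero (by rintro rfl; simp [hg] at ha)
  have hc0 : 0 < c := Nat.pos_of_ne_zero (by rintro rfl; simp [hg] at hc)
  have hin : ∀ j : ℤ, -c < j → j < a → FreeGroup.of i ^ j * g ∈ S := by
    intro j hj1 hj2
    rcases le_total 0 j with h | h
    · lift j to ℕ using h
      exact hamin j (by omega)
    · obtain ⟨k, rfl⟩ : ∃ k : ℕ, j = -k := ⟨j.natAbs, by omega⟩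
      exact hcmin k (by omega)
  refine ⟨a, c, ha0, hc0, ha, hc, hin, ?_⟩
  have hline : lineThrough S i g
      = (fun j : ℤ => FreeGroup.of i ^ j * g) '' (Finset.Ioo (-(c : ℤ)) a : Finset ℤ) := by
    ext h
    simp only [lineThrough, Set.mem_ofPred_eq, Set.mem_image, Finset.coe_Ioo, Set.mem_Ioo]
    constructor
    · rintro ⟨j, rfl, hj⟩
      refine ⟨j, ⟨?_, ?_⟩, rfl⟩
      · by_contra hcon
        exact hc (hj _ (by rw [Set.mem_uIcc]; omega))
      · by_contra hcon
        exact ha (hj _ (by rw [Set.mem_uIcc]; omega))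
    · rintro ⟨j, ⟨hj1, hj2⟩, rfl⟩
      refine ⟨j, rfl, fun l hl => ?_⟩
      rw [Set.mem_uIcc] at hl
      exact hin l (by omega) (by omega)
  rw [hline, Set.ncard_image_of_injective _ hinj, Set.ncard_coe_finset, Int.card_Ioo]
  omega

theorem ncard_lineThrough_mem {S : Set (FreeGroup (Fin m))} (hS : S.Finite) (b : Letter (Fin m))
    {g : FreeGroup (Fin m)} (hg : g ∈ S) : (lineThrough S b.1 g).ncard ∈ lineLengths S b := by
  obtain ⟨i, t⟩ := b
  obtain ⟨a, c, ha0, hc0, ha, hc, hin, hcard⟩ := lineThrough_finite_data hS i hg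
  rw [hcard]
  cases t
  · have h1 : (FreeGroup.mk [(i, false)] : FreeGroup (Fin m)) = (FreeGroup.of i)⁻¹ := by
      rw [FreeGroup.of, inv_mk_letter]; rfl
    have e : ∀ j : ℕ, ((FreeGroup.mk [(i, false)])⁻¹ ^ j) * (FreeGroup.of i ^ (-(c : ℤ) + 1) * g)
        = FreeGroup.of i ^ ((j : ℤ) - c + 1) * g := by
      intro j
      rw [h1, inv_inv, ← mul_assoc, ← zpow_natCast, ← zpow_add]
      congr 2
      ring
    refine ⟨FreeGroup.of i ^ (-(c : ℤ) + 1) * g, hin _ (by omega) (by omega), ?_, ?_, ?_⟩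
    · rw [h1, zpow_add_one, ← (Commute.refl (FreeGroup.of i)).zpow_right (-(c : ℤ)) |>.eq]
      simpa [mul_assoc] using hc
    · intro j hj
      rw [e]
      exact hin _ (by omega) (by omega)
    · rw [e, show ((a + c - 1 : ℕ) : ℤ) - c + 1 = a by omega]
      exact ha
  · have h1 : (FreeGroup.mk [(i, true)] : FreeGroup (Fin m)) = FreeGroup.of i := rfl
    have e : ∀ j : ℕ, ((FreeGroup.mk [(i, true)])⁻¹ ^ j) * (FreeGroup.of i ^ ((a : ℤ) - 1) * g)
        = FreeGroup.of i ^ ((a : ℤ) - 1 - j) * g := by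
      intro j
      rw [h1, ← mul_assoc, ← zpow_natCast, inv_zpow', ← zpow_add]
      congr 2
      ring
    refine ⟨FreeGroup.of i ^ ((a : ℤ) - 1) * g, hin _ (by omega) (by omega), ?_, ?_, ?_⟩
    · rw [h1, ← mul_assoc, mul_self_zpow]
      simpa using ha
    · intro j hj
      rw [e]
      exact hin _ (by omega) (by omega)
    · rw [e, show (a : ℤ) - 1 - (a + c - 1 : ℕ) = -c by omega]
      exact hc

theorem setGcd_lineLengths {S : Set (FreeGroup (Fin m))} (hS : S.Finite)
    (hprime : IsPrimeSubset S) (b : Letter (Fin m)) : Nat.setGcd (lineLengths S b) = 1 := by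
  by_contra h
  obtain ⟨q, hq, hqd⟩ := Nat.exists_prime_and_dvd h
  exact hprime b.1 q hq.one_lt fun g hg =>
    hqd.trans (Nat.setGcd_dvd_of_mem (ncard_lineThrough_mem hS b hg))

end Prime

section Absorb

variable {α : Type*}

/-! ### Covering one more point -/

theorem Conn.union_tiles {P S W : Set (FreeGroup α)} (hP : Conn P) (hS : Conn S)
    (h : ∀ w ∈ W, ∃ z ∈ tile P w, z ∈ S) : Conn (S ∪ tiles P W) := by
  rcases S.eq_empty_or_nonempty with rfl | ⟨x, hx⟩
  · have hW : tiles P W = ∅ := by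
      ext z
      simp only [Set.mem_empty_iff_false, iff_false]
      rintro ⟨w, hw, -⟩
      simpa using h w hw
    rwa [hW, Set.union_empty]
  intro f hf
  have h1 := hS f fun w hw c hc => hf w (Or.inl hw) c (Or.inl hc)
  have key : ∀ u ∈ S ∪ tiles P W, (f u ↔ f x) := by
    rintro u (hu | ⟨w, hw, hu⟩)
    · exact h1 u hu x hx
    · obtain ⟨z, hz, hzS⟩ := h w hw
      rw [conn_tile hP w f (fun a ha c hc => hf a (Or.inr ⟨w, hw, ha⟩) c (Or.inr ⟨w, hw, hc⟩))
        u hu z hz]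
      exact h1 z hzS x hx
  intro u hu v hv
  rw [key u hu, key v hv]

/-- The vertices of the path from `y` spelled by `l`. -/
def pathVertices (l : List (Letter α)) (y : FreeGroup α) : Set (FreeGroup α) :=
  {z | ∃ l₁ l₂, l = l₁ ++ l₂ ∧ z = FreeGroup.mk l₂ * y}

theorem conn_pathVertices (l : List (Letter α)) (y : FreeGroup α) : Conn (pathVertices l y) := by
  intro f hf
  have key : ∀ l₂ l₁, l = l₁ ++ l₂ → (f (FreeGroup.mk l₂ * y) ↔ f y) := by
    intro l₂
    induction l₂ with
    | nil => intro l₁ _; rw [← FreeGroup.one_eq_mk, one_mul]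
    | cons c l₂ ih =>
      intro l₁ hl
      have hl' : l = (l₁ ++ [c]) ++ l₂ := by simp [hl]
      rw [← ih _ hl', mk_cons c l₂, mul_assoc]
      refine (hf _ ⟨_, _, hl', rfl⟩ c ⟨_, _, hl, ?_⟩).symm
      rw [mk_cons c l₂, mul_assoc]
  rintro u ⟨l₁, l₂, h, rfl⟩ v ⟨l₁', l₂', h', rfl⟩
  rw [key _ _ h, key _ _ h']

/-- Some element of a finite set has no neighbour in the set in a given direction. -/
theorem exists_letter_mul_notMem {P : Set (FreeGroup α)} (hfin : P.Finite) (hne : P.Nonempty)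
    (c : Letter α) : ∃ p ∈ P, (FreeGroup.mk [c])⁻¹ * p ∉ P := by
  let φ : FreeGroup α →* Multiplicative ℤ :=
    FreeGroup.lift fun _ => Multiplicative.ofAdd (if c.2 then -1 else 1)
  have hφ : φ (FreeGroup.mk [c]) = Multiplicative.ofAdd (-1) := by
    obtain ⟨i, t⟩ := c
    cases t <;> simp [φ, FreeGroup.lift_mk]
  obtain ⟨p, hp, hmax⟩ := Set.exists_max_image P (fun p => (φ p).toAdd) hfin hne
  refine ⟨p, hp, fun h => ?_⟩
  have := hmax _ h
  simp only [map_mul, map_inv, hφ, toAdd_mul, toAdd_inv, toAdd_ofAdd] at this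
  omega

variable [DecidableEq α]

/-- Connected sets on different sides of an edge are disjoint. -/
theorem Conn.disjoint {S T : Set (FreeGroup α)} (hS : Conn S) (hT : Conn T) {y : FreeGroup α}
    {b : Letter α} (hSy : y ∈ S → FreeGroup.mk [b] * y ∉ S)
    (hTy : y ∈ T → FreeGroup.mk [b] * y ∉ T) {u v : FreeGroup α} (hu : u ∈ S) (hv : v ∈ T)
    (huv : u ∈ halfTree y b ↔ v ∉ halfTree y b) {z : FreeGroup α} (hz : z ∈ T) : z ∉ S := by
  intro hzS
  have h1 := hS.mem_halfTree_iff hSy hu hzS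
  have h2 := hT.mem_halfTree_iff hTy hv hz
  tauto

/-- Disjoint tiles that cover a path except for its first vertex `y`, but possibly contain
further vertices beyond its far end. -/
theorem exists_tiles_cover_path {P : Set (FreeGroup α)} (hP : Conn P) (hfin : P.Finite)
    (hne : P.Nonempty) {l : List (Letter α)} (hl : IsReduced l) (y : FreeGroup α) :
    ∃ W : Set (FreeGroup α), W.Finite ∧
      (∀ w ∈ W, ∃ l₁ l₂, l = l₁ ++ l₂ ∧ l₂ ≠ [] ∧ FreeGroup.mk l₂ * y ∈ tile P w) ∧
      (∀ w ∈ W, y ∉ tile P w) ∧ TilesDisjoint P W ∧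
      (∀ l₁ l₂, l = l₁ ++ l₂ → l₂ ≠ [] → FreeGroup.mk l₂ * y ∈ tiles P W) := by
  induction l with
  | nil =>
    refine ⟨∅, Set.finite_empty, by simp, by simp, by simp [TilesDisjoint], ?_⟩
    intro l₁ l₂ h h2
    exact absurd (List.append_eq_nil_iff.1 h.symm).2 h2
  | cons c l ih =>
    obtain ⟨W, hW, h1, h2, h3, h4⟩ := ih (hl.infix ⟨[c], [], by simp⟩)
    have h1' : ∀ w ∈ W, ∃ l₁ l₂, c :: l = l₁ ++ l₂ ∧ l₂ ≠ [] ∧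
        FreeGroup.mk l₂ * y ∈ tile P w := by
      intro w hw
      obtain ⟨l₁, l₂, rfl, h⟩ := h1 w hw
      exact ⟨c :: l₁, l₂, rfl, h⟩
    have h4' : ∀ l₁ l₂, c :: l = l₁ ++ l₂ → l₂ ≠ [] →
        l₂ = c :: l ∨ FreeGroup.mk l₂ * y ∈ tiles P W := by
      intro l₁ l₂ hl hl₂
      rcases l₁ with _ | ⟨d, l₁⟩
      · exact Or.inl hl.symm
      · rw [List.cons_append, List.cons.injEq] at hl
        exact Or.inr (h4 _ _ hl.2 hl₂)
    by_cases hcov : FreeGroup.mk (c :: l) * y ∈ tiles P W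
    · refine ⟨W, hW, h1', h2, h3, fun l₁ l₂ hl hl₂ => ?_⟩
      rcases h4' l₁ l₂ hl hl₂ with rfl | h
      · exact hcov
      · exact h
    obtain ⟨p, hp, hcp⟩ := exists_letter_mul_notMem hfin hne c
    set w₀ := p⁻¹ * (FreeGroup.mk (c :: l) * y) with hw₀
    have m1 : FreeGroup.mk (c :: l) * y ∈ tile P w₀ := by
      rw [tile, Set.mem_ofPred_eq, hw₀]
      convert hp using 1
      group
    have m2 : FreeGroup.mk l * y ∉ tile P w₀ := by
      rw [tile, Set.mem_ofPred_eq, hw₀, mk_cons]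
      convert hcp using 2
      group
    have e : FreeGroup.mk [c] * (FreeGroup.mk l * y) = FreeGroup.mk (c :: l) * y := by
      rw [mk_cons c l, mul_assoc]
    have s1 : ∀ z ∈ tile P w₀, z ∈ halfTree (FreeGroup.mk l * y) c := by
      intro z hz
      rw [(conn_tile hP w₀).mem_halfTree_iff (fun h => absurd h m2) hz m1, ← e]
      exact letter_mul_mem_halfTree _ _
    have s2 : ∀ w ∈ W, ∀ z ∈ tile P w, z ∉ halfTree (FreeGroup.mk l * y) c := by
      intro w hw z hz
      obtain ⟨l₁, l₂, rfl, hl₂, hv⟩ := h1 w hw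
      rw [(conn_tile hP w).mem_halfTree_iff (fun _ h => ?_) hz hv]
      · exact not_mem_halfTree_of_isReduced hl y
      · rw [e] at h
        exact hcov ⟨w, hw, h⟩
    refine ⟨insert w₀ W, hW.insert _, ?_, ?_, ?_, ?_⟩
    · rintro w (rfl | hw)
      · exact ⟨[], c :: l, rfl, by simp, m1⟩
      · exact h1' w hw
    · rintro w (rfl | hw)
      · intro hy
        have := not_mem_halfTree_of_isReduced (l₁ := l) (l₂ := []) (b := c) (by simpa using hl) y
        rw [← FreeGroup.one_eq_mk, one_mul, List.append_nil] at this
        exact this (s1 _ hy)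
      · exact h2 w hw
    · rintro w (rfl | hw) w' (rfl | hw') z hz hz'
      · rfl
      · exact absurd (s1 z hz) (s2 w' hw' z hz')
      · exact absurd (s1 z hz') (s2 w hw z hz)
      · exact h3 w hw w' hw' z hz hz'
    · intro l₁ l₂ hl hl₂
      rcases h4' l₁ l₂ hl hl₂ with rfl | ⟨w, hw, h⟩
      · exact ⟨w₀, Or.inl rfl, m1⟩
      · exact ⟨w, Or.inr hw, h⟩

/-- Any two elements of `D` at distance less than `K` are joined in `D`: the components of `D` are
at distance at least `K` from each other. -/
def Separated (K : ℕ) (D : Set (FreeGroup α)) : Prop :=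
  ∀ u ∈ D, ∀ v ∈ D, (u * v⁻¹).norm < K → Joined D u v

/-- An intermediate state in the construction of a connected set `A ∪ tiles P W` that contains `1`,
where `A` is a union of components of the set `D`, all of them inside `M`, and `W` consists of
the centres of disjoint tiles outside `D`. The components of `D` outside `A` keep the distance `K`
from `A` and the distance `κ` from the tiles. By `near`, the tiles stay so close to `M` and `1` that
every component of `D` which comes near them lies in `M`, if `M` is isolated in `D`. -/
structure IsMerge (P D M : Set (FreeGroup α)) (d κ K : ℕ) (A W : Set (FreeGroup α)) : Prop where
  subset : A ⊆ M
  finite : W.Finite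
  tilesDisjoint : TilesDisjoint P W
  notMem : ∀ z ∈ tiles P W, z ∉ D
  far_of_mem : ∀ a ∈ A, ∀ v ∈ D, v ∉ A → K ≤ (v * a⁻¹).norm
  far_of_mem_tiles : ∀ t ∈ tiles P W, ∀ v ∈ D, v ∉ A → κ ≤ (v * t⁻¹).norm
  conn : Conn (A ∪ tiles P W)
  one_mem : 1 ∈ tiles P W
  near : ∀ t ∈ tiles P W, ∃ y, (y ∈ M ∨ y = 1) ∧ (t * y⁻¹).norm ≤ K + d

variable {P D M : Set (FreeGroup α)} {d κ K s : ℕ}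

/-- A subset `M` that is isolated in `D` is a union of components of `D`. -/
theorem mem_of_joined (hs : 2 ≤ s)
    (hM : ∀ u ∈ D, u ∉ M → ∀ y, y ∈ M ∨ y = 1 → s ≤ (u * y⁻¹).norm) {u v : FreeGroup α}
    (hu : u ∈ M) (h : Joined D u v) : v ∈ M := by
  obtain ⟨S, hSD, hS, huS, hvS⟩ := h
  have hone : ∀ c : Letter α, ∀ z : FreeGroup α, (FreeGroup.mk [c] * z * z⁻¹).norm < s := by
    intro c z
    rw [mul_inv_cancel_right]
    have := FreeGroup.norm_mk_le (L₁ := [c])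
    rw [List.length_singleton] at this
    omega
  refine (hS (fun z => z ∈ M) (fun z hz c hc => ⟨fun h => ?_, fun h => ?_⟩) u huS v hvS).1 hu
  · by_contra hcon
    exact absurd (hM _ (hSD hc) hcon z (Or.inl h)) (not_le.2 (hone c z))
  · by_contra hcon
    have := hM _ (hSD hz) hcon _ (Or.inl h)
    rw [norm_mul_inv_comm] at this
    exact absurd this (not_le.2 (hone c z))

theorem norm_le_of_mem_tile (hd : ∀ p ∈ P, ∀ q ∈ P, (p * q⁻¹).norm ≤ d) {w z z' : FreeGroup α}
    (hz : z ∈ tile P w) (hz' : z' ∈ tile P w) : (z * z'⁻¹).norm ≤ d := by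
  have := hd _ hz _ hz'
  rwa [show z * w⁻¹ * (z' * w⁻¹)⁻¹ = z * z'⁻¹ by group] at this

theorem norm_mk_mul_inv_le (l : List (Letter α)) (y : FreeGroup α) :
    (FreeGroup.mk l * y * y⁻¹).norm ≤ l.length := by
  rw [mul_inv_cancel_right]
  exact FreeGroup.norm_mk_le

theorem norm_mk_append_mul_inv_le (l₁ l₂ : List (Letter α)) (y : FreeGroup α) :
    (FreeGroup.mk (l₁ ++ l₂) * y * (FreeGroup.mk l₂ * y)⁻¹).norm ≤ l₁.length := by
  rw [← FreeGroup.mul_mk, show FreeGroup.mk l₁ * FreeGroup.mk l₂ * y * (FreeGroup.mk l₂ * y)⁻¹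
    = FreeGroup.mk l₁ by group]
  exact FreeGroup.norm_mk_le

/-- The merging starts with a single tile if `D` is far from `1`, and otherwise with a component of
`D` nearest to `1` and tiles along the path from there to `1`. -/
theorem exists_isMerge (hP : Conn P) (hfin : P.Finite) (hne : P.Nonempty)
    (hd : ∀ p ∈ P, ∀ q ∈ P, (p * q⁻¹).norm ≤ d) (hκ : 0 < κ) (hK : K = 2 * κ + 2 * d)
    (hs : 2 * K + d < s) (hsep : Separated K D)
    (hM : ∀ u ∈ D, u ∉ M → ∀ y, y ∈ M ∨ y = 1 → s ≤ (u * y⁻¹).norm) (h1 : 1 ∉ D) :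
    ∃ A W, IsMerge P D M d κ K A W := by
  classical
  by_cases hnear : ∃ n, ∃ u ∈ D, u.norm = n ∧ n < κ + d
  · obtain ⟨u, huD, hun, hmin⟩ : ∃ u ∈ D, u.norm < κ + d ∧ ∀ v ∈ D, u.norm ≤ v.norm := by
      obtain ⟨u, hu, h2, h3⟩ := Nat.find_spec hnear
      refine ⟨u, hu, h2 ▸ h3, fun v hv => ?_⟩
      by_contra hcon
      exact Nat.find_min hnear (h2 ▸ not_le.1 hcon) ⟨v, hv, rfl, by omega⟩
    have huM : u ∈ M := by
      by_contra hcon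
      have := hM u huD hcon 1 (Or.inr rfl)
      rw [inv_one, mul_one] at this
      omega
    set l := (u⁻¹).toWord with hl
    have hlred : IsReduced l := FreeGroup.isReduced_toWord
    have hmkl : FreeGroup.mk l * u = 1 := by rw [hl, FreeGroup.mk_toWord, inv_mul_cancel]
    have hlen : l.length = u.norm := by
      rw [← FreeGroup.norm_inv_eq]
      rfl
    have hlne : l ≠ [] := by
      intro h
      rw [h, ← FreeGroup.one_eq_mk, one_mul] at hmkl
      exact h1 (hmkl ▸ huD)
    have hy : ∀ l₁ l₂, l = l₁ ++ l₂ → (FreeGroup.mk l₂ * u).norm ≤ l₁.length := by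
      intro l₁ l₂ h
      have := norm_mk_append_mul_inv_le l₁ l₂ u
      rwa [← h, hmkl, one_mul, FreeGroup.norm_inv_eq] at this
    have hyD : ∀ l₁ l₂, l = l₁ ++ l₂ → l₂ ≠ [] → FreeGroup.mk l₂ * u ∉ D := by
      intro l₁ l₂ h h2 hcon
      have h3 := hmin _ hcon
      have h4 := hy l₁ l₂ h
      have h5 := congrArg List.length h
      have h6 := List.length_pos_iff.2 h2
      rw [List.length_append] at h5
      omega
    obtain ⟨W, hW, c1, c2, c3, c4⟩ := exists_tiles_cover_path hP hfin hne hlred u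
    have hC := conn_setOf_joined D u
    have huC : u ∈ {v | Joined D u v} := Joined.refl huD
    have hfar : ∀ a, Joined D u a → ∀ v ∈ D, v ∉ {v | Joined D u v} → K ≤ (v * a⁻¹).norm := by
      intro a ha v hv hvC
      by_contra hcon
      exact hvC (ha.trans (hsep v hv a ha.mem (not_le.1 hcon)).symm)
    have hfart : ∀ t ∈ tiles P W, ∀ v ∈ D, v ∉ {v | Joined D u v} → κ ≤ (v * t⁻¹).norm := by
      rintro t ⟨w, hw, ht⟩ v hv hvC
      obtain ⟨l₁, l₂, h, hl₂, hz⟩ := c1 w hw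
      have g1 := norm_le_of_mem_tile hd ht hz
      have g2 := hfar u (Joined.refl huD) v hv hvC
      have g3 := hmin v hv
      have g4 := hy l₁ l₂ h
      have g5 := norm_mk_mul_inv_le l₂ u
      have g6 := norm_mul_inv_le v t (FreeGroup.mk l₂ * u)
      have g7 := norm_mul_inv_le v (FreeGroup.mk l₂ * u) u
      have g8 := norm_mul_inv_le v (FreeGroup.mk l₂ * u) 1
      rw [inv_one, mul_one, mul_one] at g8
      have g9 := congrArg List.length h
      rw [List.length_append] at g9
      omega
    have hdisj : ∀ w ∈ W, ∀ z ∈ tile P w, z ∉ {v | Joined D u v} := by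
      intro w hw z hz
      obtain ⟨l₁, l₂, h, hl₂, hv⟩ := c1 w hw
      rcases List.eq_nil_or_concat l₂ with rfl | ⟨l', b, rfl⟩
      · exact absurd rfl hl₂
      rw [List.concat_eq_append] at h hv
      refine hC.disjoint (conn_tile hP w) (y := u) (b := b) (fun _ hj => ?_)
        (fun hj => absurd hj (c2 w hw)) huC hv ?_ hz
      · exact hyD (l₁ ++ l') [b] (by simp [h]) (by simp) hj.mem
      · have m1 := not_mem_halfTree_self u b
        have m2 := mem_halfTree_of_isReduced (l₁ := l') (l₂ := []) (b := b)
          (hlred.infix ⟨l₁, [], by simp [h]⟩) u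
        rw [← FreeGroup.one_eq_mk, one_mul] at m2
        tauto
    refine ⟨{v | Joined D u v}, W, ?_, hW, c3, ?_, hfar, hfart, ?_, ?_, ?_⟩
    · intro v hv
      exact mem_of_joined (by omega) hM huM hv
    · rintro z ⟨w, hw, hz⟩ hzD
      have := hfart z ⟨w, hw, hz⟩ z hzD (hdisj w hw z hz)
      rw [mul_inv_cancel, FreeGroup.norm_one] at this
      omega
    · have q1 := hC.union (conn_pathVertices l u) huC
        ⟨l, [], by simp, by rw [← FreeGroup.one_eq_mk, one_mul]⟩
      have q2 := Conn.union_tiles hP q1 (W := W) fun w hw => by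
        obtain ⟨l₁, l₂, h, hl₂, hv⟩ := c1 w hw
        exact ⟨_, hv, Or.inr ⟨l₁, l₂, h, rfl⟩⟩
      convert q2 using 1
      refine (Set.union_subset_union_left _ Set.subset_union_left).antisymm ?_
      refine Set.union_subset (Set.union_subset Set.subset_union_left ?_) Set.subset_union_right
      rintro z ⟨l₁, l₂, h, rfl⟩
      rcases eq_or_ne l₂ [] with rfl | hl₂
      · rw [← FreeGroup.one_eq_mk, one_mul]
        exact Or.inl huC
      · exact Or.inr (c4 l₁ l₂ h hl₂)
    · have := c4 [] l rfl hlne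
      rwa [hmkl] at this
    · rintro t ⟨w, hw, ht⟩
      refine ⟨1, Or.inr rfl, ?_⟩
      obtain ⟨l₁, l₂, h, hl₂, hz⟩ := c1 w hw
      have g1 := norm_le_of_mem_tile hd ht hz
      have g4 := hy l₁ l₂ h
      have g6 := norm_mul_inv_le t (FreeGroup.mk l₂ * u) 1
      rw [inv_one, mul_one, mul_one] at g6
      rw [inv_one, mul_one]
      have g9 := congrArg List.length h
      rw [List.length_append] at g9
      omega
  · push Not at hnear
    obtain ⟨p, hp⟩ := hne
    have hmem : (1 : FreeGroup α) ∈ tile P p⁻¹ := by simpa [tile] using hp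
    have htiles : tiles P {p⁻¹} = tile P p⁻¹ := by
      ext z
      simp [tiles]
    have hfart : ∀ t ∈ tile P p⁻¹, ∀ v ∈ D, κ ≤ (v * t⁻¹).norm := by
      intro t ht v hv
      have g1 := norm_le_of_mem_tile hd ht hmem
      have g2 := hnear _ v hv rfl
      have g3 := norm_mul_inv_le v t 1
      rw [inv_one, mul_one] at g1
      rw [inv_one, mul_one, mul_one] at g3
      omega
    refine ⟨∅, {p⁻¹}, Set.empty_subset _, Set.finite_singleton _, ?_, ?_, by simp, ?_, ?_, ?_, ?_⟩
    · rintro w rfl w' rfl - - -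
      rfl
    · rw [htiles]
      intro z hz hzD
      have := hfart z hz z hzD
      rw [mul_inv_cancel, FreeGroup.norm_one] at this
      omega
    · rw [htiles]
      exact fun t ht v hv _ => hfart t ht v hv
    · rw [htiles, Set.empty_union]
      exact conn_tile hP _
    · rwa [htiles]
    · rw [htiles]
      intro t ht
      refine ⟨1, Or.inr rfl, ?_⟩
      have := norm_le_of_mem_tile hd ht hmem
      omega

/-- As long as some component of `D` outside `A` comes closer than `K` to the merged set, fill the
path to a nearest one and add its component. By minimality and the triangle inequality, every
vertex of that path is at distance at least `K / 2` from all other components. -/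
theorem IsMerge.exists_ssubset (hP : Conn P) (hd : ∀ p ∈ P, ∀ q ∈ P, (p * q⁻¹).norm ≤ d)
    (hκ : 0 < κ) (hK : K = 2 * κ + 2 * d) (hs : 2 * K + d < s) (hsep : Separated K D)
    (hM : ∀ u ∈ D, u ∉ M → ∀ y, y ∈ M ∨ y = 1 → s ≤ (u * y⁻¹).norm)
    (hfill : ∀ l : List (Letter α), IsReduced l → κ ≤ l.length → Fillable P l)
    {A W : Set (FreeGroup α)} (h : IsMerge P D M d κ K A W)
    (hclose : ∃ v ∈ D, v ∉ A ∧ ∃ e ∈ tiles P W, (v * e⁻¹).norm < K) :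
    ∃ A' W', IsMerge P D M d κ K A' W' ∧ A ⊂ A' := by
  classical
  obtain ⟨v, hvD, hvA, e, he, hve, hmin⟩ : ∃ v ∈ D, v ∉ A ∧ ∃ e ∈ tiles P W,
      (v * e⁻¹).norm < K ∧ ∀ v' ∈ D, v' ∉ A → ∀ e' ∈ A ∪ tiles P W,
        (v * e⁻¹).norm ≤ (v' * e'⁻¹).norm := by
    have hex : ∃ n, ∃ v ∈ D, v ∉ A ∧ ∃ e ∈ tiles P W, (v * e⁻¹).norm = n ∧ n < K := by
      obtain ⟨v, hv, hvA, e, he, hve⟩ := hclose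
      exact ⟨_, v, hv, hvA, e, he, rfl, hve⟩
    obtain ⟨v, hv, hvA, e, he, hve, hn⟩ := Nat.find_spec hex
    refine ⟨v, hv, hvA, e, he, hve ▸ hn, ?_⟩
    rintro v' hv' hvA' e' (he' | he')
    · have := h.far_of_mem e' he' v' hv' hvA'
      omega
    · by_contra hcon
      exact Nat.find_min hex (hve ▸ not_le.1 hcon) ⟨v', hv', hvA', e', he', rfl, by omega⟩
  have hvM : v ∈ M := by
    by_contra hcon
    obtain ⟨y, hy, hey⟩ := h.near e he
    have g1 := hM v hvD hcon y hy
    have g2 := norm_mul_inv_le v e y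
    omega
  set l := (v * e⁻¹).toWord with hl
  have hlred : IsReduced l := FreeGroup.isReduced_toWord
  have hmkl : FreeGroup.mk l * e = v := by rw [hl, FreeGroup.mk_toWord, inv_mul_cancel_right]
  have hlen : l.length = (v * e⁻¹).norm := rfl
  have heE : e ∈ A ∪ tiles P W := Or.inr he
  have hy1 : ∀ l₁ l₂, l = l₁ ++ l₂ → (v * (FreeGroup.mk l₂ * e)⁻¹).norm ≤ l₁.length := by
    intro l₁ l₂ hll
    have := norm_mk_append_mul_inv_le l₁ l₂ e
    rwa [← hll, hmkl] at this
  -- The inner vertices of the path lie neither in the merged set nor in `D`.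
  have hyE : ∀ l₁ l₂, l = l₁ ++ l₂ → l₂ ≠ [] → FreeGroup.mk l₂ * e ∉ A ∪ tiles P W := by
    intro l₁ l₂ hll h2 hcon
    have g1 := hmin v hvD hvA _ hcon
    have g2 := hy1 l₁ l₂ hll
    have g3 := congrArg List.length hll
    have g4 := List.length_pos_iff.2 h2
    rw [List.length_append] at g3
    omega
  have hyD : ∀ l₁ l₂, l = l₁ ++ l₂ → l₁ ≠ [] → l₂ ≠ [] → FreeGroup.mk l₂ * e ∉ D := by
    intro l₁ l₂ hll h1 h2 hcon
    have g1 := hmin _ hcon (fun hA => hyE l₁ l₂ hll h2 (Or.inl hA)) e heE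
    have g2 := norm_mk_mul_inv_le l₂ e
    have g3 := congrArg List.length hll
    have g4 := List.length_pos_iff.2 h1
    rw [List.length_append] at g3
    omega
  obtain ⟨W₁, hW₁, c1, c2, c3, c4⟩ :=
    hfill l hlred (hlen ▸ h.far_of_mem_tiles e he v hvD hvA) e
  set C : Set (FreeGroup α) := {c | Joined D v c} with hCdef
  have hC : Conn C := conn_setOf_joined D v
  have hvC : v ∈ C := Joined.refl hvD
  have hfarC : ∀ c ∈ C, ∀ v' ∈ D, v' ∉ C → K ≤ (v' * c⁻¹).norm := by
    intro c hc v' hv' hvC'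
    by_contra hcon
    exact hvC' (Joined.trans hc (hsep v' hv' c (Joined.mem hc) (not_le.1 hcon)).symm)
  have hfart : ∀ t ∈ tiles P W₁, ∀ v' ∈ D, v' ∉ A ∪ C → κ ≤ (v' * t⁻¹).norm := by
    rintro t ⟨w, hw, ht⟩ v' hv' hvAC
    obtain ⟨l₁, l₂, hll, hl₁, hl₂, hz⟩ := c1 w hw
    have g1 := norm_le_of_mem_tile hd ht hz
    have g2 := hfarC v hvC v' hv' fun hc => hvAC (Or.inr hc)
    have g3 := hmin v' hv' (fun hc => hvAC (Or.inl hc)) e heE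
    have g4 := hy1 l₁ l₂ hll
    have g5 := norm_mk_mul_inv_le l₂ e
    have g6 := norm_mul_inv_le v' t (FreeGroup.mk l₂ * e)
    have g7 := norm_mul_inv_le v' (FreeGroup.mk l₂ * e) e
    have g8 := norm_mul_inv_le v' (FreeGroup.mk l₂ * e) v
    rw [norm_mul_inv_comm (FreeGroup.mk l₂ * e) v] at g8
    have g9 := congrArg List.length hll
    rw [List.length_append] at g9
    omega
  have hdisjE : ∀ w ∈ W₁, ∀ z ∈ tile P w, z ∉ A ∪ tiles P W := by
    intro w hw z hz
    obtain ⟨l₁, l₂, hll, hl₁, hl₂, hv⟩ := c1 w hw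
    rcases List.eq_nil_or_concat l₂ with rfl | ⟨l', b, rfl⟩
    · exact absurd rfl hl₂
    rw [List.concat_eq_append] at hll hv
    refine h.conn.disjoint (conn_tile hP w) (y := e) (b := b) (fun _ hj => ?_)
      (fun hj => absurd hj (c2 w hw).1) heE hv ?_ hz
    · exact hyE (l₁ ++ l') [b] (by simp [hll]) (by simp) hj
    · have m1 := not_mem_halfTree_self e b
      have m2 := mem_halfTree_of_isReduced (l₁ := l') (l₂ := []) (b := b)
        (hlred.infix ⟨l₁, [], by simp [hll]⟩) e
      rw [← FreeGroup.one_eq_mk, one_mul] at m2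
      tauto
  have hdisjC : ∀ w ∈ W₁, ∀ z ∈ tile P w, z ∉ C := by
    intro w hw z hz
    obtain ⟨l₁, l₂, hll, hl₁, hl₂, hv⟩ := c1 w hw
    obtain ⟨b, l', rfl⟩ := List.exists_cons_of_ne_nil hl₁
    have hb : FreeGroup.mk [b] * (FreeGroup.mk (l' ++ l₂) * e) = v := by
      rw [← hmkl, hll, List.cons_append, mk_cons b (l' ++ l₂), mul_assoc]
    refine hC.disjoint (conn_tile hP w) (y := FreeGroup.mk (l' ++ l₂) * e) (b := b)
      (fun hj => ?_) (fun _ hj => ?_) hvC hv ?_ hz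
    · exact absurd (Joined.mem hj) (hyD [b] (l' ++ l₂) hll (by simp) (by simp [hl₂]))
    · rw [hb, ← hmkl] at hj
      exact (c2 w hw).2 hj
    · have m1 := letter_mul_mem_halfTree (FreeGroup.mk (l' ++ l₂) * e) b
      rw [hb] at m1
      have m2 := not_mem_halfTree_of_isReduced (l₁ := l') (l₂ := l₂) (b := b) (hll ▸ hlred) e
      tauto
  refine ⟨A ∪ C, W ∪ W₁, ⟨?_, h.finite.union hW₁, ?_, ?_, ?_, ?_, ?_, ?_, ?_⟩,
    Set.ssubset_iff_subset_ne.2 ⟨Set.subset_union_left, fun hA => hvA (hA ▸ Or.inr hvC)⟩⟩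
  · exact Set.union_subset h.subset fun c hc => mem_of_joined (by omega) hM hvM hc
  · rintro w (hw | hw) w' (hw' | hw') z hz hz'
    · exact h.tilesDisjoint w hw w' hw' z hz hz'
    · exact absurd (Or.inr ⟨w, hw, hz⟩) (hdisjE w' hw' z hz')
    · exact absurd (Or.inr ⟨w', hw', hz'⟩) (hdisjE w hw z hz)
    · exact c3 w hw w' hw' z hz hz'
  · rintro z ⟨w, hw | hw, hz⟩ hzD
    · exact h.notMem z ⟨w, hw, hz⟩ hzD
    · have := hfart z ⟨w, hw, hz⟩ z hzD fun hc => hc.elim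
        (fun hA => hdisjE w hw z hz (Or.inl hA)) (hdisjC w hw z hz)
      rw [mul_inv_cancel, FreeGroup.norm_one] at this
      omega
  · rintro a (ha | ha) v' hv' hvAC
    · exact h.far_of_mem a ha v' hv' fun hc => hvAC (Or.inl hc)
    · exact hfarC a ha v' hv' fun hc => hvAC (Or.inr hc)
  · rintro t ⟨w, hw | hw, ht⟩ v' hv' hvAC
    · exact h.far_of_mem_tiles t ⟨w, hw, ht⟩ v' hv' fun hc => hvAC (Or.inl hc)
    · exact hfart t ⟨w, hw, ht⟩ v' hv' hvAC
  · have q1 := (h.conn.union (conn_pathVertices l e) heE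
      ⟨l, [], by simp, by rw [← FreeGroup.one_eq_mk, one_mul]⟩).union hC
      (Or.inr ⟨[], l, rfl, hmkl.symm⟩) hvC
    have q2 := Conn.union_tiles hP q1 (W := W₁) fun w hw => by
      obtain ⟨l₁, l₂, hll, hl₁, hl₂, hv⟩ := c1 w hw
      exact ⟨_, hv, Or.inl (Or.inr ⟨l₁, l₂, hll, rfl⟩)⟩
    convert q2 using 1
    ext z
    constructor
    · rintro ((hz | hz) | ⟨w, hw | hw, hz⟩)
      · exact Or.inl (Or.inl (Or.inl (Or.inl hz)))
      · exact Or.inl (Or.inr hz)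
      · exact Or.inl (Or.inl (Or.inl (Or.inr ⟨w, hw, hz⟩)))
      · exact Or.inr ⟨w, hw, hz⟩
    · have hW : ∀ z, z ∈ tiles P W → z ∈ (A ∪ C) ∪ tiles P (W ∪ W₁) := by
        rintro z ⟨w, hw, hz⟩
        exact Or.inr ⟨w, Or.inl hw, hz⟩
      have hW' : ∀ z, z ∈ tiles P W₁ → z ∈ (A ∪ C) ∪ tiles P (W ∪ W₁) := by
        rintro z ⟨w, hw, hz⟩
        exact Or.inr ⟨w, Or.inr hw, hz⟩
      rintro ((((hz | hz) | ⟨l₁, l₂, hll, rfl⟩) | hz) | hz)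
      · exact Or.inl (Or.inl hz)
      · exact hW z hz
      · rcases eq_or_ne l₂ [] with rfl | hl₂
        · rw [← FreeGroup.one_eq_mk, one_mul]
          exact hW e he
        · rcases eq_or_ne l₁ [] with rfl | hl₁
          · rw [List.nil_append] at hll
            rw [← hll, hmkl]
            exact Or.inl (Or.inr hvC)
          · exact hW' _ (c4 l₁ l₂ hll hl₁ hl₂)
      · exact Or.inl (Or.inr hz)
      · exact hW' z hz
  · obtain ⟨w, hw, hz⟩ := h.one_mem
    exact ⟨w, Or.inl hw, hz⟩
  · rintro t ⟨w, hw | hw, ht⟩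
    · exact h.near t ⟨w, hw, ht⟩
    · refine ⟨v, Or.inl hvM, ?_⟩
      obtain ⟨l₁, l₂, hll, hl₁, hl₂, hz⟩ := c1 w hw
      have g1 := norm_le_of_mem_tile hd ht hz
      have g4 := hy1 l₁ l₂ hll
      have g6 := norm_mul_inv_le t (FreeGroup.mk l₂ * e) v
      rw [norm_mul_inv_comm (FreeGroup.mk l₂ * e) v] at g6
      have g9 := congrArg List.length hll
      rw [List.length_append] at g9
      omega

/-- Finitely many additional tiles cover the point `1` and merge with some components of `D` into
one connected set which has distance at least `K` from the rest of `D`. -/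
theorem exists_isMerge_far (hP : Conn P) (hfin : P.Finite) (hne : P.Nonempty)
    (hd : ∀ p ∈ P, ∀ q ∈ P, (p * q⁻¹).norm ≤ d) (hκ : 0 < κ) (hK : K = 2 * κ + 2 * d)
    (hs : 2 * K + d < s) (hsep : Separated K D) (hMfin : M.Finite)
    (hM : ∀ u ∈ D, u ∉ M → ∀ y, y ∈ M ∨ y = 1 → s ≤ (u * y⁻¹).norm)
    (hfill : ∀ l : List (Letter α), IsReduced l → κ ≤ l.length → Fillable P l) (h1 : 1 ∉ D) :
    ∃ A W, IsMerge P D M d κ K A W ∧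
      ∀ v ∈ D, v ∉ A → ∀ t ∈ tiles P W, K ≤ (v * t⁻¹).norm := by
  have hfinA : {A | ∃ W, IsMerge P D M d κ K A W}.Finite :=
    hMfin.finite_subsets.subset fun A ⟨W, h⟩ => h.subset
  obtain ⟨A, ⟨W, h⟩, hmax⟩ :=
    hfinA.exists_maximal (exists_isMerge hP hfin hne hd hκ hK hs hsep hM h1)
  refine ⟨A, W, h, ?_⟩
  by_contra hcon
  push Not at hcon
  obtain ⟨A', W', h', hA⟩ := h.exists_ssubset hP hd hκ hK hs hsep hM hfill hcon
  exact hA.2 (hmax ⟨W', h'⟩ hA.1)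

end Absorb

section Action

variable {α : Type*} [DecidableEq α] {X : Type*} [MulAction (FreeGroup α) X]

/-! ### Tilings of the orbits with an open set of centres -/

/-- The tile centres that a set `U` of centres induces on the orbit of `x`, which is identified
with the free group by `w ↦ w x`. -/
def centres (U : Set X) (x : X) : Set (FreeGroup α) := {w | w • x ∈ U}

/-- The partial tiling with centres in the open set `U` leaves enough room to be extended, with
bounds that are uniform in the orbit: the components of the covered set are at distance `K`, and
each point `z` has a neighbourhood `M` in the covered set which, together with `z`, is at distance
`s` from the rest of the covered set and has radius at most `N` around `z`. -/
structure IsExtendable [TopologicalSpace X] (P : Set (FreeGroup α)) (K s N : ℕ) (U : Set X) :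
    Prop where
  isOpen : IsOpen U
  tilesDisjoint : ∀ x : X, TilesDisjoint P (centres U x)
  separated : ∀ x : X, Separated K (tiles P (centres U x))
  isolated : ∀ (x : X) (z : FreeGroup α), ∃ M ⊆ tiles P (centres U x),
    (∀ y ∈ M, (y * z⁻¹).norm ≤ N) ∧
      ∀ u ∈ tiles P (centres U x), u ∉ M → ∀ y, y ∈ M ∨ y = z → s ≤ (u * y⁻¹).norm

/-- A small neighbourhood `V` of `x` looks the same from all of its points, within the radius `R`,
and returns to itself only beyond this radius. -/
theorem exists_open_nhd [TopologicalSpace X] [T2Space X] [ContinuousConstSMul (FreeGroup α) X]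
    [Finite α] {U : Set X} (hU : IsOpen U) {x : X} (hfree : ∀ g : FreeGroup α, g ≠ 1 → g • x ≠ x)
    (hx : ∀ g : FreeGroup α, g • x ∉ frontier U) (R : ℕ) :
    ∃ V : Set X, IsOpen V ∧ x ∈ V ∧
      (∀ g : FreeGroup α, g.norm ≤ R → ∀ v ∈ V, (g • v ∈ U ↔ g • x ∈ U)) ∧
      (∀ g : FreeGroup α, g.norm ≤ R → g ≠ 1 → ∀ v ∈ V, g • v ∉ V) := by
  have key : ∀ g : FreeGroup α, ∃ V : Set X, IsOpen V ∧ x ∈ V ∧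
      (∀ v ∈ V, (g • v ∈ U ↔ g • x ∈ U)) ∧ (g ≠ 1 → ∀ v ∈ V, g • v ∉ V) := by
    intro g
    have hg : Continuous fun v : X => g • v := continuous_const_smul g
    obtain ⟨V₁, hV₁, hxV₁, h1⟩ : ∃ V : Set X, IsOpen V ∧ x ∈ V ∧
        ∀ v ∈ V, (g • v ∈ U ↔ g • x ∈ U) := by
      by_cases hgx : g • x ∈ U
      · exact ⟨_, hU.preimage hg, hgx, fun v hv => iff_of_true hv hgx⟩
      · refine ⟨_, (isClosed_closure (s := U)).isOpen_compl.preimage hg, fun hcl => ?_,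
          fun v hv => iff_of_false (fun h => hv (subset_closure h)) hgx⟩
        exact hx g ⟨hcl, by rwa [hU.interior_eq]⟩
    rcases eq_or_ne g 1 with rfl | hne
    · exact ⟨V₁, hV₁, hxV₁, h1, fun h => absurd rfl h⟩
    · obtain ⟨A, B, hA, hB, hxA, hxB, hAB⟩ := t2_separation (hfree g hne)
      refine ⟨V₁ ∩ (B ∩ (fun v => g • v) ⁻¹' A), hV₁.inter (hB.inter (hA.preimage hg)),
        ⟨hxV₁, hxB, hxA⟩, fun v hv => h1 v hv.1, fun _ v hv hgv => ?_⟩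
      exact Set.disjoint_left.1 hAB hv.2.2 hgv.2.1
  choose V hV hxV h1 h2 using key
  refine ⟨⋂ g ∈ {g : FreeGroup α | g.norm ≤ R}, V g, (finite_norm_le R).isOpen_biInter
    fun g _ => hV g, Set.mem_iInter₂.2 fun g _ => hxV g, ?_, ?_⟩
  · intro g hg v hv
    exact h1 g v (Set.mem_iInter₂.1 hv g hg)
  · intro g hg hne v hv hgv
    exact h2 g hne v (Set.mem_iInter₂.1 hv g hg) (Set.mem_iInter₂.1 hgv g hg)

variable [TopologicalSpace X] {P : Set (FreeGroup α)} {d κ K s N : ℕ} {U : Set X}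

/-- An extendable partial tiling extends to one which covers a given generic point `x₀`: repeat
the tiles that cover `x₀` at all points of a small neighbourhood of `x₀`. -/
theorem IsExtendable.exists_cover [T2Space X] [ContinuousConstSMul (FreeGroup α) X] [Finite α]
    (hP : Conn P) (hfin : P.Finite) (hne : P.Nonempty)
    (hd : ∀ p ∈ P, ∀ q ∈ P, (p * q⁻¹).norm ≤ d) (hκ : 0 < κ) (hK : K = 2 * κ + 2 * d)
    (hs : 2 * K + d < s)
    (hfill : ∀ l : List (Letter α), IsReduced l → κ ≤ l.length → Fillable P l)
    (hU : IsExtendable P K s N U) {x₀ : X}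
    (hfree : ∀ g : FreeGroup α, g ≠ 1 → g • x₀ ≠ x₀) (hx₀ : ∀ g : FreeGroup α, g • x₀ ∉ frontier U)
    (h1 : 1 ∉ tiles P (centres U x₀)) :
    ∃ N' U', IsExtendable P K s N' U' ∧ U ⊆ U' ∧ 1 ∈ tiles P (centres U' x₀) := by
  obtain ⟨M, hMD, hMN, hM⟩ := hU.isolated x₀ 1
  have hMfin : M.Finite := (finite_norm_le N).subset fun y hy => by simpa using hMN y hy
  obtain ⟨A, W, hAW, hfar⟩ := exists_isMerge_far hP hfin hne hd hκ hK hs (hU.separated x₀) hMfin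
    hM hfill h1
  obtain ⟨ρ, hρP, hρA, hρT⟩ : ∃ ρ : ℕ, (∀ p ∈ P, p.norm ≤ ρ) ∧ (∀ a ∈ A, a.norm ≤ ρ) ∧
      ∀ t ∈ tiles P W, t.norm ≤ ρ := by
    obtain ⟨a, ha⟩ := (hfin.image FreeGroup.norm).bddAbove
    obtain ⟨b, hb⟩ := ((hMfin.subset hAW.subset).image FreeGroup.norm).bddAbove
    obtain ⟨c, hc⟩ := (hAW.finite.image FreeGroup.norm).bddAbove
    refine ⟨a + b + c, fun p hp => ?_, fun p hp => ?_, ?_⟩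
    · have := ha ⟨p, hp, rfl⟩
      omega
    · have := hb ⟨p, hp, rfl⟩
      omega
    · rintro t ⟨w, hw, ht⟩
      have g1 := ha ⟨_, ht, rfl⟩
      have g2 := hc ⟨w, hw, rfl⟩
      have g3 := FreeGroup.norm_mul_le (t * w⁻¹) w
      rw [inv_mul_cancel_right] at g3
      omega
  -- The radius exceeds all distances between points of two visits that are compared below.
  obtain ⟨V, hV, hxV, hVU, hVV⟩ := exists_open_nhd hU.isOpen hfree hx₀ (6 * ρ + 3 * s + 3 * N + K)
  -- Two visits of an orbit to `V` at bounded distance are the same visit.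
  have hVeq : ∀ x : X, ∀ g g' : FreeGroup α, g • x ∈ V → g' • x ∈ V →
      (g' * g⁻¹).norm ≤ 6 * ρ + 3 * s + 3 * N + K → g' = g := by
    intro x g g' hg hg' hn
    by_contra hcon
    refine hVV (g' * g⁻¹) hn (fun h => hcon (mul_inv_eq_one.1 h)) _ hg ?_
    rwa [mul_smul, inv_smul_smul]
  -- Around such a visit, the covered set is the same as around `x₀`.
  have hwin : ∀ x : X, ∀ g : FreeGroup α, g • x ∈ V → ∀ t : FreeGroup α, t.norm ≤ K + ρ →
      (t * g ∈ tiles P (centres U x) ↔ t ∈ tiles P (centres U x₀)) := by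
    intro x g hg t ht
    have hn : ∀ w : FreeGroup α, t * w⁻¹ ∈ P → w.norm ≤ 6 * ρ + 3 * s + 3 * N + K := by
      intro w hw
      have g1 := hρP _ hw
      have g2 := FreeGroup.norm_mul_le (t * w⁻¹)⁻¹ t
      rw [FreeGroup.norm_inv_eq, show (t * w⁻¹)⁻¹ * t = w by group] at g2
      omega
    constructor
    · rintro ⟨w, hw, hz⟩
      have hz' : t * (w * g⁻¹)⁻¹ ∈ P := by
        rwa [show t * (w * g⁻¹)⁻¹ = t * g * w⁻¹ by group]
      refine ⟨w * g⁻¹, ?_, hz'⟩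
      refine (hVU _ (hn _ hz') _ hg).1 ?_
      rwa [mul_smul, inv_smul_smul]
    · rintro ⟨w, hw, hz⟩
      refine ⟨w * g, ?_, ?_⟩
      · have := (hVU w (hn w hz) _ hg).2 hw
        rwa [← mul_smul] at this
      · rw [tile, Set.mem_ofPred_eq, show t * g * (w * g)⁻¹ = t * w⁻¹ by group]
        exact hz
  set U' : Set X := U ∪ {x | ∃ w ∈ W, w⁻¹ • x ∈ V} with hU'
  have hcen : ∀ x : X, ∀ w, w ∈ centres U' x ↔ w ∈ centres U x ∨
      ∃ w₀ ∈ W, ∃ g : FreeGroup α, g • x ∈ V ∧ w = w₀ * g := by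
    intro x w
    refine or_congr Iff.rfl ⟨?_, ?_⟩
    · rintro ⟨w₀, hw₀, h⟩
      exact ⟨w₀, hw₀, w₀⁻¹ * w, by rwa [mul_smul], by group⟩
    · rintro ⟨w₀, hw₀, g, hg, rfl⟩
      refine ⟨w₀, hw₀, ?_⟩
      rwa [mul_smul, inv_smul_smul]
  have hD' : ∀ x : X, ∀ u, u ∈ tiles P (centres U' x) ↔ u ∈ tiles P (centres U x) ∨
      ∃ t ∈ tiles P W, ∃ g : FreeGroup α, g • x ∈ V ∧ u = t * g := by
    intro x u
    constructor
    · rintro ⟨w, hw, hz⟩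
      rcases (hcen x w).1 hw with h | ⟨w₀, hw₀, g, hg, rfl⟩
      · exact Or.inl ⟨w, h, hz⟩
      · refine Or.inr ⟨u * g⁻¹, ⟨w₀, hw₀, ?_⟩, g, hg, by group⟩
        rw [tile, Set.mem_ofPred_eq] at hz ⊢
        rwa [show u * g⁻¹ * w₀⁻¹ = u * (w₀ * g)⁻¹ by group]
    · rintro (⟨w, hw, hz⟩ | ⟨t, ⟨w₀, hw₀, hz⟩, g, hg, rfl⟩)
      · exact ⟨w, (hcen x w).2 (Or.inl hw), hz⟩
      · refine ⟨w₀ * g, (hcen x _).2 (Or.inr ⟨w₀, hw₀, g, hg, rfl⟩), ?_⟩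
        rw [tile, Set.mem_ofPred_eq] at hz ⊢
        rwa [show t * g * (w₀ * g)⁻¹ = t * w₀⁻¹ by group]
  refine ⟨2 * N + s + 2 * ρ, U', ⟨?_, ?_, ?_, ?_⟩, Set.subset_union_left, ?_⟩
  · have : {x : X | ∃ w ∈ W, w⁻¹ • x ∈ V} = ⋃ w ∈ W, (fun x : X => w⁻¹ • x) ⁻¹' V := by
      ext x
      simp
    rw [hU', this]
    exact hU.isOpen.union (isOpen_biUnion fun w _ => hV.preimage (continuous_const_smul w⁻¹))
  · have hmix : ∀ x : X, ∀ w ∈ centres U x, ∀ w₀ ∈ W, ∀ g : FreeGroup α, g • x ∈ V → ∀ z,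
        z ∈ tile P w → z ∉ tile P (w₀ * g) := by
      intro x w hw w₀ hw₀ g hg z hz hz'
      have ht : z * g⁻¹ ∈ tiles P W := by
        refine ⟨w₀, hw₀, ?_⟩
        rw [tile, Set.mem_ofPred_eq] at hz' ⊢
        rwa [show z * g⁻¹ * w₀⁻¹ = z * (w₀ * g)⁻¹ by group]
      refine hAW.notMem _ ht ((hwin x g hg _ ?_).1 ?_)
      · have := hρT _ ht
        omega
      · rw [inv_mul_cancel_right]
        exact ⟨w, hw, hz⟩
    intro x w hw w' hw' z hz hz'
    rcases (hcen x w).1 hw with hw | ⟨w₀, hw₀, g, hg, rfl⟩ <;>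
      rcases (hcen x w').1 hw' with hw' | ⟨w₁, hw₁, g', hg', rfl⟩
    · exact hU.tilesDisjoint x w hw w' hw' z hz hz'
    · exact absurd hz' (hmix x w hw w₁ hw₁ g' hg' z hz)
    · exact absurd hz (hmix x w' hw' w₀ hw₀ g hg z hz')
    · have ht : z * g⁻¹ ∈ tile P w₀ := by
        rw [tile, Set.mem_ofPred_eq] at hz ⊢
        rwa [show z * g⁻¹ * w₀⁻¹ = z * (w₀ * g)⁻¹ by group]
      have ht' : z * g'⁻¹ ∈ tile P w₁ := by
        rw [tile, Set.mem_ofPred_eq] at hz' ⊢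
        rwa [show z * g'⁻¹ * w₁⁻¹ = z * (w₁ * g')⁻¹ by group]
      have hgg : g' = g := by
        refine hVeq x g g' hg hg' ?_
        have g1 := hρT _ ⟨_, hw₀, ht⟩
        have g2 := hρT _ ⟨_, hw₁, ht'⟩
        have g3 := FreeGroup.norm_mul_le (z * g'⁻¹)⁻¹ (z * g⁻¹)
        rw [FreeGroup.norm_inv_eq, show (z * g'⁻¹)⁻¹ * (z * g⁻¹) = g' * g⁻¹ by group] at g3
        omega
      subst hgg
      rw [hAW.tilesDisjoint w₀ hw₀ w₁ hw₁ _ ht ht']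
  · intro x
    have key : ∀ t ∈ tiles P W, ∀ g : FreeGroup α, g • x ∈ V → ∀ v ∈ tiles P (centres U' x),
        (v * (t * g)⁻¹).norm < K → Joined (tiles P (centres U' x)) (t * g) v := by
      intro t ht g hg v hv hlt
      suffices h : v * g⁻¹ ∈ A ∪ tiles P W by
        refine ⟨{z | z * g⁻¹ ∈ A ∪ tiles P W}, ?_, hAW.conn.translate g⁻¹, ?_, h⟩
        · rintro z (hz | hz)
          · refine (hD' x z).2 (Or.inl ?_)
            have := (hwin x g hg (z * g⁻¹) ?_).2 (hMD (hAW.subset hz))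
            · rwa [inv_mul_cancel_right] at this
            · have := hρA _ hz
              omega
          · exact (hD' x z).2 (Or.inr ⟨_, hz, g, hg, by group⟩)
        · rw [Set.mem_ofPred_eq, mul_inv_cancel_right]
          exact Or.inr ht
      have ht' := hρT t ht
      rcases (hD' x v).1 hv with hv | ⟨t₁, ht₁, g₁, hg₁, rfl⟩
      · rw [show v * (t * g)⁻¹ = v * g⁻¹ * t⁻¹ by group] at hlt
        have hv₀ : v * g⁻¹ ∈ tiles P (centres U x₀) := by
          refine (hwin x g hg (v * g⁻¹) ?_).1 (by rwa [inv_mul_cancel_right])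
          have := FreeGroup.norm_mul_le (v * g⁻¹ * t⁻¹) t
          rw [inv_mul_cancel_right] at this
          omega
        by_contra hcon
        exact absurd (hfar _ hv₀ (fun h => hcon (Or.inl h)) t ht) (not_le.2 hlt)
      · have hgg : g₁ = g := by
          refine hVeq x g g₁ hg hg₁ ?_
          have g1 := hρT t₁ ht₁
          have g2 := FreeGroup.norm_mul_le (t₁⁻¹ * (t₁ * g₁ * (t * g)⁻¹)) t
          have g3 := FreeGroup.norm_mul_le t₁⁻¹ (t₁ * g₁ * (t * g)⁻¹)
          rw [show t₁⁻¹ * (t₁ * g₁ * (t * g)⁻¹) * t = g₁ * g⁻¹ by group] at g2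
          rw [FreeGroup.norm_inv_eq] at g3
          omega
        subst hgg
        rw [mul_inv_cancel_right]
        exact Or.inr ht₁
    intro u hu v hv huv
    rcases (hD' x u).1 hu with hu' | ⟨t, ht, g, hg, rfl⟩
    · rcases (hD' x v).1 hv with hv' | ⟨t, ht, g, hg, rfl⟩
      · exact (hU.separated x u hu' v hv' huv).mono fun z hz => (hD' x z).2 (Or.inl hz)
      · exact (key t ht g hg u hu huv).symm
    · rw [norm_mul_inv_comm] at huv
      exact key t ht g hg v hv huv
  · intro x z
    have hsub : tiles P (centres U x) ⊆ tiles P (centres U' x) :=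
      fun u hu => (hD' x u).2 (Or.inl hu)
    choose Mx hMx hMxN hMxs using hU.isolated x
    by_cases hnew : ∃ t ∈ tiles P W, ∃ g : FreeGroup α, g • x ∈ V ∧
        ∃ y, (y ∈ Mx z ∨ y = z) ∧ (t * g * y⁻¹).norm < s
    · obtain ⟨t, ht, g, hg, y₀, hy₀, hlt⟩ := hnew
      have htz : (t * g * z⁻¹).norm ≤ s + N := by
        have g1 : (y₀ * z⁻¹).norm ≤ N := by
          rcases hy₀ with h | rfl
          · exact hMxN z _ h
          · simp
        have g2 := norm_mul_inv_le (t * g) y₀ z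
        omega
      have htt : ∀ t' ∈ tiles P W, (t' * g * z⁻¹).norm ≤ 2 * ρ + s + N := by
        intro t' ht'
        have g1 := hρT t ht
        have g2 := hρT t' ht'
        have g3 := norm_mul_inv_le (t' * g) (t * g) z
        have g4 := FreeGroup.norm_mul_le t' t⁻¹
        rw [FreeGroup.norm_inv_eq] at g4
        rw [show t' * g * (t * g)⁻¹ = t' * t⁻¹ by group] at g3
        omega
      set M' : Set (FreeGroup α) := Mx z ∪
        {y | ∃ t' ∈ tiles P W, y = t' * g ∨ y ∈ Mx (t' * g)} with hM'
      have hN' : ∀ y ∈ M', (y * z⁻¹).norm ≤ 2 * N + s + 2 * ρ := by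
        rintro y (hy | ⟨t', ht', rfl | hy⟩)
        · have := hMxN z y hy
          omega
        · have := htt t' ht'
          omega
        · have g1 := htt t' ht'
          have g2 := hMxN _ y hy
          have g3 := norm_mul_inv_le y (t' * g) z
          omega
      refine ⟨M', ?_, hN', ?_⟩
      · rintro y (hy | ⟨t', ht', rfl | hy⟩)
        · exact hsub (hMx z hy)
        · exact (hD' x _).2 (Or.inr ⟨t', ht', g, hg, rfl⟩)
        · exact hsub (hMx _ hy)
      · intro v hv hvM y hy
        rcases (hD' x v).1 hv with hv' | ⟨t₁, ht₁, g₁, hg₁, rfl⟩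
        · rcases hy with (hy | ⟨t', ht', hy⟩) | hy
          · exact hMxs z v hv' (fun h => hvM (Or.inl h)) y (Or.inl hy)
          · exact hMxs _ v hv' (fun h => hvM (Or.inr ⟨t', ht', Or.inr h⟩)) y hy.symm
          · exact hMxs z v hv' (fun h => hvM (Or.inl h)) y (Or.inr hy)
        · by_contra hcon
          have hgg : g₁ = g := by
            refine hVeq x g g₁ hg hg₁ ?_
            have g0 : (y * z⁻¹).norm ≤ 2 * N + s + 2 * ρ := by
              rcases hy with hy | rfl
              · exact hN' y hy
              · simp
            have g1 := hρT t₁ ht₁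
            have g2 := hρT t ht
            have g3 := norm_mul_inv_le (t₁ * g₁) y z
            have g4 := norm_mul_inv_le (t₁ * g₁) z (t * g)
            rw [norm_mul_inv_comm z] at g4
            have g5 := FreeGroup.norm_mul_le (t₁⁻¹ * (t₁ * g₁ * (t * g)⁻¹)) t
            have g6 := FreeGroup.norm_mul_le t₁⁻¹ (t₁ * g₁ * (t * g)⁻¹)
            rw [show t₁⁻¹ * (t₁ * g₁ * (t * g)⁻¹) * t = g₁ * g⁻¹ by group] at g5
            rw [FreeGroup.norm_inv_eq] at g6
            omega
          subst hgg
          exact hvM (Or.inr ⟨t₁, ht₁, Or.inl rfl⟩)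
    · push Not at hnew
      refine ⟨Mx z, (hMx z).trans hsub, fun y hy => (hMxN z y hy).trans (by omega), ?_⟩
      intro v hv hvM y hy
      rcases (hD' x v).1 hv with hv' | ⟨t₁, ht₁, g₁, hg₁, rfl⟩
      · exact hMxs z v hv' hvM y hy
      · exact hnew t₁ ht₁ g₁ hg₁ y hy
  · exact (hD' x₀ 1).2 (Or.inr ⟨1, hAW.one_mem, 1, by rwa [one_smul], (one_mul 1).symm⟩)

end Action

section Generic

variable {α : Type*} [DecidableEq α] {X : Type*} [MulAction (FreeGroup α) X]
  [TopologicalSpace X] {P : Set (FreeGroup α)} {d κ K s N : ℕ} {U : Set X}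

theorem isExtendable_empty (P : Set (FreeGroup α)) (K s : ℕ) :
    IsExtendable P K s 0 (∅ : Set X) := by
  have h : ∀ x : X, tiles P (centres (∅ : Set X) x) = ∅ := by
    intro x
    ext z
    simp [tiles, centres]
  refine ⟨isOpen_empty, fun x w hw => absurd hw (by simp [centres]), fun x u hu => ?_,
    fun x z => ⟨∅, Set.empty_subset _, by simp, fun u hu => ?_⟩⟩
  · rw [h] at hu
    exact absurd hu (Set.notMem_empty u)
  · rw [h] at hu
    exact absurd hu (Set.notMem_empty u)

theorem residual_orbit_notMem_frontier [Finite α] [ContinuousConstSMul (FreeGroup α) X]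
    (hU : IsOpen U) : {x : X | ∀ g : FreeGroup α, g • x ∉ frontier U} ∈ residual X := by
  have : {x : X | ∀ g : FreeGroup α, g • x ∉ frontier U}
      = ⋂ g : FreeGroup α, (fun x : X => g • x) ⁻¹' (frontier U)ᶜ := by
    ext x
    simp
  have hcount : Countable (FreeGroup α) := FreeGroup.toWord_injective.countable
  rw [this, countable_iInter_mem]
  intro g
  refine residual_of_dense_open (isClosed_frontier.isOpen_compl.preimage
    (continuous_const_smul g)) (Dense.preimage ?_ (isOpenMap_smul g))
  rw [← interior_eq_empty_iff_dense_compl, ← frontier_compl]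
  exact interior_frontier hU.isClosed_compl

/-- If a free group acts generically freely by homeomorphisms on a Polish space, then a tile which
is suitable for filling paths has an open set of disjoint translates with dense union. -/
theorem exists_isOpen_tiling [Finite α] [PolishSpace X] [Nonempty X]
    [ContinuousConstSMul (FreeGroup α) X]
    (hfree : {x : X | ∀ g : FreeGroup α, g ≠ 1 → g • x ≠ x} ∈ residual X)
    (hP : Conn P) (hfin : P.Finite) (hne : P.Nonempty)
    (hgcd : ∀ b : Letter α, Nat.setGcd (lineLengths P b) = 1) :
    ∃ U : Set X, IsOpen U ∧ (∀ x : X, TilesDisjoint P (centres U x)) ∧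
      Dense {x : X | 1 ∈ tiles P (centres U x)} := by
  obtain ⟨κ₀, hκ₀⟩ := exists_forall_fillable hP hfin hne hgcd
  obtain ⟨d, hd⟩ := ((hfin.prod hfin).image fun q => (q.1 * q.2⁻¹).norm).bddAbove
  have hd' : ∀ p ∈ P, ∀ q ∈ P, (p * q⁻¹).norm ≤ d := fun p hp q hq => hd ⟨(p, q), ⟨hp, hq⟩, rfl⟩
  obtain ⟨κ, hκ, hfill⟩ : ∃ κ, 0 < κ ∧
      ∀ l : List (Letter α), IsReduced l → κ ≤ l.length → Fillable P l :=
    ⟨κ₀ + 1, Nat.succ_pos _, fun l hl hlen => hκ₀ l hl hlen⟩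
  -- A tile which contains a point at distance `K / 2` from a set is at distance `K / 2 - d = κ` from
  -- it, so that the paths from the tile to the set are long enough to be filled.
  obtain ⟨K, hK⟩ : ∃ K, K = 2 * κ + 2 * d := ⟨_, rfl⟩
  obtain ⟨s, hs⟩ : ∃ s, 2 * K + d < s := ⟨_, Nat.lt_succ_self _⟩
  have hbaire : BaireSpace X := by
    let _ := TopologicalSpace.upgradeIsCompletelyMetrizable X
    infer_instance
  have step : ∀ (U : {U : Set X // ∃ N, IsExtendable P K s N U}) (B : Set X), IsOpen B →
      B.Nonempty → ∃ U' : {U : Set X // ∃ N, IsExtendable P K s N U}, U.1 ⊆ U'.1 ∧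
        ∃ x ∈ B, 1 ∈ tiles P (centres U'.1 x) := by
    rintro ⟨U, N, hU⟩ B hB hBne
    by_cases hcov : ∃ x ∈ B, 1 ∈ tiles P (centres U x)
    · exact ⟨⟨U, N, hU⟩, subset_rfl, hcov⟩
    push Not at hcov
    obtain ⟨x, hxB, hx1, hx2⟩ := (dense_of_mem_residual (Filter.inter_mem hfree
      (residual_orbit_notMem_frontier (α := α) hU.isOpen))).inter_open_nonempty B hB hBne
    obtain ⟨N', U', h1, h2, h3⟩ := hU.exists_cover hP hfin hne hd' hκ hK hs hfill hx1 hx2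
      (hcov x hxB)
    exact ⟨⟨U', N', h1⟩, h2, x, hxB, h3⟩
  obtain ⟨B, hB⟩ := (TopologicalSpace.countable_countableBasis X).exists_eq_range (by
    obtain ⟨x⟩ := ‹Nonempty X›
    obtain ⟨b, hb, -⟩ := (TopologicalSpace.isBasis_countableBasis X).exists_subset_of_mem_open
      (Set.mem_univ x) isOpen_univ
    exact ⟨b, hb⟩)
  have hBmem : ∀ n, B n ∈ TopologicalSpace.countableBasis X := fun n => hB ▸ Set.mem_range_self n
  choose next hnext hnextB using fun (U : {U : Set X // ∃ N, IsExtendable P K s N U}) (n : ℕ) =>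
    step U (B n) (TopologicalSpace.isOpen_of_mem_countableBasis (hBmem n))
      (TopologicalSpace.nonempty_of_mem_countableBasis (hBmem n))
  let seq : ℕ → {U : Set X // ∃ N, IsExtendable P K s N U} :=
    fun n => Nat.rec ⟨∅, 0, isExtendable_empty P K s⟩ (fun n U => next U n) n
  have hmono : Monotone fun n => (seq n).1 := monotone_nat_of_le_succ fun n => hnext (seq n) n
  refine ⟨⋃ n, (seq n).1, isOpen_iUnion fun n => (seq n).2.choose_spec.isOpen, ?_, ?_⟩
  · intro x w hw w' hw' z hz hz'
    obtain ⟨i, hi⟩ := Set.mem_iUnion.1 hw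
    obtain ⟨j, hj⟩ := Set.mem_iUnion.1 hw'
    exact (seq (max i j)).2.choose_spec.tilesDisjoint x w (hmono (le_max_left i j) hi) w'
      (hmono (le_max_right i j) hj) z hz hz'
  · rw [(TopologicalSpace.isBasis_countableBasis X).dense_iff]
    intro o ho _
    rw [hB] at ho
    obtain ⟨n, rfl⟩ := ho
    obtain ⟨x, hx, w, hw, hz⟩ := hnextB (seq n) n
    exact ⟨x, hx, w, Set.mem_iUnion.2 ⟨n + 1, hw⟩, hz⟩

end Generic

section Embedding

/-! ### Free subgroups of higher rank -/

/-- The action of `ℤ` on the free group on `ℤ` that shifts the generators. -/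
noncomputable def shiftHom : Multiplicative ℤ →* MulAut (FreeGroup ℤ) where
  toFun n := FreeGroup.freeGroupCongr (Equiv.addRight n.toAdd)
  map_one' := by
    ext x
    induction x using FreeGroup.induction_on <;> simp_all
  map_mul' a b := by
    ext x
    have : (FreeGroup.freeGroupCongr (Equiv.addRight (a * b).toAdd) : MulAut (FreeGroup ℤ))
        = (FreeGroup.freeGroupCongr (Equiv.addRight a.toAdd) : MulAut (FreeGroup ℤ)) *
          FreeGroup.freeGroupCongr (Equiv.addRight b.toAdd) := by
      apply MulEquiv.toMonoidHom_injective
      ext i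
      simp [add_comm, add_left_comm]
    rw [this]

theorem shiftHom_of (n : ℤ) (i : ℤ) :
    shiftHom (Multiplicative.ofAdd n) (FreeGroup.of i) = FreeGroup.of (i + n) := by
  simp [shiftHom]

/-- A group which is free on more than one generator contains free groups of all finite ranks: if
`x` and `y` are distinct basis elements, then the `xⁿ y x⁻ⁿ` are free, because they map to free
generators of the normal factor of the semidirect product of a free group on `ℤ` by the shift. -/
theorem exists_injective_hom {G ι : Type*} [Group G] (b : FreeGroupBasis ι G) {x y : ι}
    (hxy : x ≠ y) (m : ℕ) : ∃ φ : FreeGroup (Fin m) →* G, Function.Injective φ := by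
  classical
  let ψ : G →* FreeGroup ℤ ⋊[shiftHom] Multiplicative ℤ := b.lift fun i =>
    if i = x then SemidirectProduct.inr (Multiplicative.ofAdd 1)
    else if i = y then SemidirectProduct.inl (FreeGroup.of 0) else 1
  have hx : ψ (b x) = SemidirectProduct.inr (Multiplicative.ofAdd 1) := by simp [ψ]
  have hy : ψ (b y) = SemidirectProduct.inl (FreeGroup.of 0) := by simp [ψ, hxy.symm]
  let φ : FreeGroup (Fin m) →* G :=
    FreeGroup.lift fun k => b x ^ (k : ℕ) * b y * (b x ^ (k : ℕ))⁻¹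
  have hcomp : ψ.comp φ = (SemidirectProduct.inl).comp
      (FreeGroup.map fun k : Fin m => ((k : ℕ) : ℤ)) := by
    ext1 k
    have : (SemidirectProduct.inr (Multiplicative.ofAdd 1) :
        FreeGroup ℤ ⋊[shiftHom] Multiplicative ℤ) ^ (k : ℕ)
          = SemidirectProduct.inr (Multiplicative.ofAdd ((k : ℕ) : ℤ)) := by
      rw [← map_pow, ← ofAdd_nsmul]
      simp
    simp only [MonoidHom.comp_apply, φ, FreeGroup.lift_apply_of, map_mul, map_inv, map_pow, hx, hy,
      this, FreeGroup.map.of]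
    rw [← map_inv, ← SemidirectProduct.inl_aut, shiftHom_of, zero_add]
  refine ⟨φ, Function.Injective.of_comp (f := ψ) ?_⟩
  have hinj : Function.Injective fun z : FreeGroup (Fin m) => (SemidirectProduct.inl
      (FreeGroup.map (fun k : Fin m => ((k : ℕ) : ℤ)) z) :
        FreeGroup ℤ ⋊[shiftHom] Multiplicative ℤ) :=
    SemidirectProduct.inl_injective.comp
      (FreeGroup.map_injective fun a c h => Fin.ext (by exact_mod_cast h))
  exact fun u v huv => hinj (by
    have h1 := DFunLike.congr_fun hcomp u
    have h2 := DFunLike.congr_fun hcomp v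
    simp only [MonoidHom.comp_apply] at h1 h2
    show SemidirectProduct.inl _ = SemidirectProduct.inl _
    rw [← h1, ← h2]
    exact huv)

end Embedding

end GroupTiling

theorem theorem4p3 (r : ℕ) (hr : 0 < r) (C : Set (SetCongruence r))
    (hC : ∃ (m : ℕ) (P : Fin r → Set (FreeGroup (Fin m))),
      (∀ k, (P k).Finite) ∧ (∀ k, (P k).Nonempty) ∧
      SatisfiesCongruences (FreeGroup (Fin m)) C P ∧
      IsConnectedSubset (⋃ k, P k) ∧ IsPrimeSubset (⋃ k, P k))
    {X : Type*} {G : Type*} [TopologicalSpace X] [Nonempty X] [Group G] [MulAction G X]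
    (hXG : IsSuitableSpace X G) :
    ∃ A : Fin r → Set X,
      (∀ k, IsOpen (A k)) ∧ (∀ k, (A k).Nonempty) ∧
      (∀ k l, k ≠ l → Disjoint (A k) (A l)) ∧
      Dense (⋃ k, A k) ∧
      SatisfiesCongruences G C A := by
  open GroupTiling in
  obtain ⟨m, P, hfin, hne, ⟨hdisj, hcong⟩, hconn, hprime⟩ := hC
  obtain ⟨hpolish, -, ⟨S, ⟨x, hx, y, hy, hxy⟩, b, -⟩, hcont, Y, hY, hYfree⟩ := hXG
  obtain ⟨φ, hφ⟩ := exists_injective_hom b (x := ⟨x, hx⟩) (y := ⟨y, hy⟩)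
    (fun h => hxy (congrArg Subtype.val h)) m
  let _ : MulAction (FreeGroup (Fin m)) X := MulAction.compHom X φ
  have hsmul : ∀ (g : FreeGroup (Fin m)) (z : X), g • z = φ g • z := fun _ _ => rfl
  have : ContinuousConstSMul (FreeGroup (Fin m)) X := ⟨fun g => hcont (φ g)⟩
  have hPfin : (⋃ k, P k).Finite := Set.finite_iUnion hfin
  have hPne : (⋃ k, P k).Nonempty := by
    obtain ⟨p, hp⟩ := hne ⟨0, hr⟩
    exact ⟨p, Set.mem_iUnion.2 ⟨_, hp⟩⟩
  obtain ⟨U, hU, hUdisj, hUdense⟩ := exists_isOpen_tiling (X := X) (P := ⋃ k, P k)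
    (Filter.mem_of_superset hY fun z hz g hg => hYfree (φ g)
      (fun h => hg (hφ (h.trans (map_one φ).symm))) z hz)
    (conn_of_isConnectedSubset hconn) hPfin hPne (setGcd_lineLengths hPfin hprime)
  -- Points `p u` of the tiled part determine both `p` and `u`.
  have huniq : ∀ p ∈ ⋃ k, P k, ∀ q ∈ ⋃ k, P k, ∀ u ∈ U, ∀ v ∈ U, p • u = q • v → p = q := by
    intro p hp q hq u hu v hv huv
    have h := hUdisj u 1 (by simpa [centres] using hu) (q⁻¹ * p)
      (by rw [centres, Set.mem_ofPred_eq, mul_smul, huv, inv_smul_smul]; exact hv) p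
      (by simpa [tile] using hp)
      (by rw [tile, Set.mem_ofPred_eq, show p * (q⁻¹ * p)⁻¹ = q by group]; exact hq)
    exact (inv_mul_eq_one.1 h.symm).symm
  have hUne : U.Nonempty := by
    obtain ⟨z, w, hw, -⟩ := hUdense.nonempty
    exact ⟨_, hw⟩
  have hmem : ∀ (k : Fin r) (z : X), z ∈ (⋃ p ∈ P k, (fun z : X => p • z) '' U) ↔
      ∃ p ∈ P k, ∃ u ∈ U, p • u = z := by
    intro k z
    simp
  have hA : ∀ k l : Fin r, k ≠ l → Disjoint (⋃ p ∈ P k, (fun z : X => p • z) '' U)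
      (⋃ p ∈ P l, (fun z : X => p • z) '' U) := by
    intro k l hkl
    rw [Set.disjoint_left]
    intro z hz hz'
    obtain ⟨p, hp, u, hu, rfl⟩ := (hmem k z).1 hz
    obtain ⟨q, hq, v, hv, hqv⟩ := (hmem l _).1 hz'
    have := huniq q (Set.mem_iUnion.2 ⟨l, hq⟩) p (Set.mem_iUnion.2 ⟨k, hp⟩) v hv u hu hqv
    exact Set.disjoint_left.1 (hdisj k l hkl) hp (this ▸ hq)
  refine ⟨fun k => ⋃ p ∈ P k, (fun z : X => p • z) '' U, fun k => ?_, fun k => ?_, hA, ?_, hA, ?_⟩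
  · exact isOpen_biUnion fun p _ => isOpenMap_smul p _ hU
  · obtain ⟨p, hp⟩ := hne k
    obtain ⟨u, hu⟩ := hUne
    exact ⟨p • u, (hmem k _).2 ⟨p, hp, u, hu, rfl⟩⟩
  · refine hUdense.mono ?_
    rintro z ⟨w, hw, hz⟩
    rw [tile, Set.mem_ofPred_eq, one_mul] at hz
    obtain ⟨k, hk⟩ := Set.mem_iUnion.1 hz
    exact Set.mem_iUnion.2 ⟨k, (hmem k z).2 ⟨w⁻¹, hk, w • z, hw, inv_smul_smul w z⟩⟩
  · intro c hc
    obtain ⟨σ, hσ⟩ := hcong c hc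
    refine ⟨φ σ, ?_⟩
    ext z
    constructor
    · rintro ⟨z', hz', rfl⟩
      obtain ⟨k, hk, hz'⟩ := Set.mem_iUnion₂.1 hz'
      obtain ⟨p, hp, u, hu, rfl⟩ := (hmem k z').1 hz'
      have : σ • p ∈ ⋃ k ∈ c.right, P k := hσ ▸ ⟨p, Set.mem_iUnion₂.2 ⟨k, hk, hp⟩, rfl⟩
      obtain ⟨l, hl, hq⟩ := Set.mem_iUnion₂.1 this
      refine Set.mem_iUnion₂.2 ⟨l, hl, (hmem l _).2 ⟨σ • p, hq, u, hu, ?_⟩⟩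
      rw [smul_eq_mul, mul_smul]
      rfl
    · intro hz
      obtain ⟨l, hl, hz⟩ := Set.mem_iUnion₂.1 hz
      obtain ⟨q, hq, u, hu, rfl⟩ := (hmem l z).1 hz
      have : q ∈ (fun x => σ • x) '' ⋃ k ∈ c.left, P k :=
        hσ ▸ Set.mem_iUnion₂.2 ⟨l, hl, hq⟩
      obtain ⟨p, hp, rfl⟩ := this
      obtain ⟨k, hk, hp⟩ := Set.mem_iUnion₂.1 hp
      refine ⟨p • u, Set.mem_iUnion₂.2 ⟨k, hk, (hmem k _).2 ⟨p, hp, u, hu, rfl⟩⟩, ?_⟩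
      show φ σ • p • u = (σ * p) • u
      rw [mul_smul]
      rfl
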